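/- **Setting.** Let $S$ be a compact metrizable space, let $A$ and $\mathcal Z$ be separable metrizable spaces (all with their Borel $\sigma$-algebras), and write $\mathbb P(X)$ for the set of Borel probability measures on $X$ with the topology of weak convergence. Given are: sets $D(x)\subset A$ $(x\in S)$ such that $D:=\{(x,a)\in S\times A: a\in D(x)\}$ contains the graph of a measurable map $S\to A$; a measurable map $T:S\times A\times\mathbb P(S)\times\mathcal Z\times\mathcal Z\to S$; a bounded function $r:S\times A\times\mathbb P(S)\to\mathbb R$; a $\mathcal Z$-valued random variable $Z$ with law $\mathbb P^Z$; and, independent of $Z$, an i.i.d. sequence $Z^0_1,Z^0_2,\dots$ in $\mathcal Z$ (the common noise), $Z^0$ denoting a generic member. For $\mu\in\mathbb P(S)$ let $\tilde D(\mu)$ be the set of $Q\in\mathbb P(D)$ with first marginal $\mu$, and for $Q\in\tilde D(\mu)$, $z^0\in\mathcal Z$ put $$\tilde r(\mu,Q)=\int_D r(x,a,\mu)\,Q(d(x,a)),\qquad \tilde T(\mu,Q,z^0)(B)=\int_D \mathbb P^Z\big(\{z: T(x,a,\mu,z,z^0)\in B\}\big)\,Q(d(x,a)).$$ A decision rule is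 a measurable $\varphi:\mathbb P(S)\to\mathbb P(D)$ with $\varphi(\mu)\in\tilde D(\mu)$ for all $\mu$; a policy is a sequence $\psi=(\varphi_0,\varphi_1,\dots)$ of decision rules. With $\mu_0=\mu$ and $\mu_{n+1}=\tilde T(\mu_n,\varphi_n(\mu_n),Z^0_{n+1})$ set, for $\beta\in(0,1)$, $$J^\beta_\psi(\mu)=\sum_{k\ge0}\beta^k\,\mathbb E^\psi_\mu[\tilde r(\mu_k,\varphi_k(\mu_k))],\quad J^\beta=\sup_\psi J^\beta_\psi,\quad G_\psi(\mu)=\liminf_{n\to\infty}\frac1n\sum_{k=0}^{n-1}\mathbb E^\psi_\mu[\tilde r(\mu_k,\varphi_k(\mu_k))],\quad G=\sup_\psi G_\psi .$$ A policy $\psi$ is average-reward optimal if $G_\psi(\mu)=G(\mu)$ for all $\mu$; a decision rule $\varphi$ is $\beta$-optimal if $J^\beta_{(\varphi,\varphi,\dots)}(\mu)=J^\beta(\mu)$ for all $\mu$. **Assumptions.** - (A0) $D$ is compact. - (A1) If $x_n\to x$ in $S$ and $a_n\in D(x_n)$, then $(a_n)$ has an accumulation point in $D(x)$. - (A2') $r$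 is continuous. - (A3') $\mathcal Z$ is compact and $T$ is continuous. - (A4) For a fixed $\nu\in\mathbb P(S)$ there are $L>0$, $\bar\beta\in(0,1)$ and $M:\mathbb P(S)\to\mathbb R$ such that $M(\mu)\le J^\beta(\mu)-J^\beta(\nu)\le L$ for all $\mu\in\mathbb P(S)$ and all $\beta\in[\bar\beta,1)$. **Theorem 5.3.** Under (A0), (A1), (A2'), (A3') and (A4) let $\rho:=\limsup_{\beta\uparrow1}(1-\beta)J^\beta(\nu)$. Then there is an upper semicontinuous $h:\mathbb P(S)\to\mathbb R$ such that the following hold. a) For all $\mu\in\mathbb P(S)$, $$\rho+h(\mu)\le\sup_{Q\in\tilde D(\mu)}\Big\{\tilde r(\mu,Q)+\mathbb E\big[h(\tilde T(\mu,Q,Z^0))\big]\Big\},$$ where the expectation takes values in $[-\infty,\infty)$; and there is a maximizer, i.e. a decision rule $\varphi^*$ such that $\varphi^*(\mu)$ attains the supremum on the right for every $\mu$. b) For every such maximizer $\varphi^*$ the stationary policy $(\varphi^*,\varphi^*,\dots)$ is average-reward optimal, and $\rho$ is the maximal average reward: $G(\mu)=\rho$ for all $\mu\in\mathbb P(S)$.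 Moreover, for every $\beta\in(0,1)$ there is a $\beta$-optimal decision rule, and for every choice of $\beta$-optimal decision rules $\varphi^\beta$, $\beta\in(0,1)$, there is a decision rule $\varphi^0$ such that the stationary policy $(\varphi^0,\varphi^0,\dots)$ is average-reward optimal and for each $\mu\in\mathbb P(S)$ there are a strictly increasing sequence $\beta_m(\mu)\in(0,1)$ with $\beta_m(\mu)\uparrow1$ and a sequence $\mu_m(\mu)\to\mu$ in $\mathbb P(S)$ with $$\varphi^0(\mu)=\lim_{m\to\infty}\varphi^{\beta_m(\mu)}(\mu_m(\mu)).$$ -/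

import Mathlib

open MeasureTheory Filter Topology Set
open scoped ENNReal

noncomputable section

/-- The data of the mean-field control model with the standing requirements on them:
state space `S`, action space `A`, disturbance space `𝒵`. -/
structure MeanFieldModel (S A 𝒵 : Type*) [MeasurableSpace S] [MeasurableSpace A]
    [MeasurableSpace 𝒵] where
  /-- actions available to an individual in state `x` -/
  D : S → Set A
  /-- the constraint set contains the graph of a measurable map -/
  exists_selector : ∃ f : S → A, Measurable f ∧ ∀ x, f x ∈ D x
  /-- individual transition function `T(x, a, μ, z, z⁰)` -/
  T : S → A → ProbabilityMeasure S → 𝒵 → 𝒵 → S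
  measurable_T : Measurable fun p : S × A × ProbabilityMeasure S × 𝒵 × 𝒵 =>
    T p.1 p.2.1 p.2.2.1 p.2.2.2.1 p.2.2.2.2
  /-- individual one-stage reward `r(x, a, μ)` -/
  r : S → A → ProbabilityMeasure S → ℝ
  bounded_r : ∃ C : ℝ, ∀ x a μ, |r x a μ| ≤ C
  /-- law of the idiosyncratic disturbances -/
  lawZ : ProbabilityMeasure 𝒵
  /-- law of the common noise -/
  lawZ0 : ProbabilityMeasure 𝒵

/-- Expectation of a real function in the extended reals, `E[f⁺] - E[f⁻]`.
It is meaningful as soon as `E[f⁺] < ∞`, in particular for `f` bounded above; the value `-∞`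
is possible. -/
def extExpectation {Ω : Type*} [MeasurableSpace Ω] (P : Measure Ω) (f : Ω → ℝ) : EReal :=
  ((∫⁻ ω, ENNReal.ofReal (f ω) ∂P : ℝ≥0∞) : EReal)
    - ((∫⁻ ω, ENNReal.ofReal (-(f ω)) ∂P : ℝ≥0∞) : EReal)

namespace MeanFieldModel

variable {S A 𝒵 : Type*} [MeasurableSpace S] [MeasurableSpace A] [MeasurableSpace 𝒵]

/-- The set of admissible state-action pairs `{(x, a) | a ∈ D(x)}`. -/
def graph (M : MeanFieldModel S A 𝒵) : Set (S × A) := {p | p.2 ∈ M.D p.1}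

/-- The first marginal of a probability measure on admissible state-action pairs. -/
def firstMargin (M : MeanFieldModel S A 𝒵) (Q : ProbabilityMeasure M.graph) :
    ProbabilityMeasure S :=
  Q.map (f := fun p : M.graph => p.1.1)
    (measurable_fst.comp measurable_subtype_coe).aemeasurable

/-- Actions of the limit problem admissible in `μ`: the `Q` with first marginal `μ`. -/
def admissible (M : MeanFieldModel S A 𝒵) (μ : ProbabilityMeasure S) :
    Set (ProbabilityMeasure M.graph) := {Q | M.firstMargin Q = μ}

/-- One-stage reward of the limit problem, `∫ r(x, a, μ) Q(d(x, a))`. -/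
def limitReward (M : MeanFieldModel S A 𝒵) (μ : ProbabilityMeasure S)
    (Q : ProbabilityMeasure M.graph) : ℝ :=
  ∫ p : M.graph, M.r p.1.1 p.1.2 μ ∂(Q : Measure M.graph)

lemma measurable_T_slice (M : MeanFieldModel S A 𝒵) (μ : ProbabilityMeasure S) (z0 : 𝒵) :
    Measurable fun q : M.graph × 𝒵 => M.T q.1.1.1 q.1.1.2 μ q.2 z0 := by
  have h : Measurable fun q : M.graph × 𝒵 =>
      ((q.1.1.1, q.1.1.2, μ, q.2, z0) : S × A × ProbabilityMeasure S × 𝒵 × 𝒵) := by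
    fun_prop
  exact M.measurable_T.comp h

lemma measurable_T_disturbance (M : MeanFieldModel S A 𝒵) (x : S) (a : A)
    (μ : ProbabilityMeasure S) (z0 : 𝒵) : Measurable fun z : 𝒵 => M.T x a μ z z0 := by
  have h : Measurable fun z : 𝒵 =>
      ((x, a, μ, z, z0) : S × A × ProbabilityMeasure S × 𝒵 × 𝒵) := by
    fun_prop
  exact M.measurable_T.comp h

/-- Law of the next state of an individual, given its state `x`, its action `a`, the
distribution `μ` and the common noise `z0`. -/
def individualLaw (M : MeanFieldModel S A 𝒵) (x : S) (a : A) (μ : ProbabilityMeasure S)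
    (z0 : 𝒵) : ProbabilityMeasure S :=
  M.lawZ.map (f := fun z => M.T x a μ z z0) (M.measurable_T_disturbance x a μ z0).aemeasurable

/-- Transition function of the limit problem: the law of `T(x, a, μ, Z, z0)` when `(x, a)` has
law `Q` and `Z` is an independent disturbance; `limitTransition_apply` gives it as the
`Q`-mixture of the individual laws. -/
def limitTransition (M : MeanFieldModel S A 𝒵) (μ : ProbabilityMeasure S)
    (Q : ProbabilityMeasure M.graph) (z0 : 𝒵) : ProbabilityMeasure S :=
  (Q.prod M.lawZ).map (f := fun q : M.graph × 𝒵 => M.T q.1.1.1 q.1.1.2 μ q.2 z0)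
    (M.measurable_T_slice μ z0).aemeasurable

lemma limitTransition_apply (M : MeanFieldModel S A 𝒵) (μ : ProbabilityMeasure S)
    (Q : ProbabilityMeasure M.graph) (z0 : 𝒵) {B : Set S} (hB : MeasurableSet B) :
    (M.limitTransition μ Q z0 : Measure S) B
      = ∫⁻ p : M.graph, (M.individualLaw p.1.1 p.1.2 μ z0 : Measure S) B
          ∂(Q : Measure M.graph) := by
  have hm := M.measurable_T_slice μ z0
  simp only [limitTransition, individualLaw, ProbabilityMeasure.toMeasure_map,
    ProbabilityMeasure.toMeasure_prod]
  rw [Measure.map_apply hm hB, Measure.prod_apply (hm hB)]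
  refine lintegral_congr fun p => ?_
  rw [Measure.map_apply (M.measurable_T_disturbance p.1.1 p.1.2 μ z0) hB]
  rfl

/-- Decision rules of the limit problem: measurable selections of the admissible actions. -/
def DecisionRule (M : MeanFieldModel S A 𝒵) : Type _ :=
  {φ : ProbabilityMeasure S → ProbabilityMeasure M.graph //
    Measurable φ ∧ ∀ μ, φ μ ∈ M.admissible μ}

/-- Policies: sequences of decision rules. -/
abbrev Policy (M : MeanFieldModel S A 𝒵) : Type _ := ℕ → M.DecisionRule

/-- The stationary policy `(φ, φ, …)`. -/
def stationary {M : MeanFieldModel S A 𝒵} (φ : M.DecisionRule) : M.Policy := fun _ => φ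

/-- The state process `μ₀ = μ`, `μ_{n+1} = T̃(μ_n, φ_n(μ_n), Z⁰_{n+1})`, where the coordinate
`ω n` of `ω : ℕ → 𝒵` is the common noise entering the transition from time `n` to `n + 1`. -/
def state (M : MeanFieldModel S A 𝒵) (ψ : M.Policy) (μ : ProbabilityMeasure S)
    (ω : ℕ → 𝒵) : ℕ → ProbabilityMeasure S
  | 0 => μ
  | n + 1 => M.limitTransition (M.state ψ μ ω n) ((ψ n).1 (M.state ψ μ ω n)) (ω n)

/-- The law of the i.i.d. sequence of common noises. -/
def noiseLaw (M : MeanFieldModel S A 𝒵) : Measure (ℕ → 𝒵) :=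
  Measure.infinitePi fun _ : ℕ => (M.lawZ0 : Measure 𝒵)

/-- The expected reward `E_μ^ψ[r̃(μ_k, φ_k(μ_k))]` at time `k`. -/
def expReward (M : MeanFieldModel S A 𝒵) (ψ : M.Policy) (μ : ProbabilityMeasure S)
    (k : ℕ) : ℝ :=
  ∫ ω, M.limitReward (M.state ψ μ ω k) ((ψ k).1 (M.state ψ μ ω k)) ∂M.noiseLaw

/-- Expected `β`-discounted reward of a policy. -/
def discReward (M : MeanFieldModel S A 𝒵) (β : ℝ) (ψ : M.Policy)
    (μ : ProbabilityMeasure S) : ℝ :=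
  ∑' k : ℕ, β ^ k * M.expReward ψ μ k

/-- Maximal expected `β`-discounted reward. -/
def discValue (M : MeanFieldModel S A 𝒵) (β : ℝ) (μ : ProbabilityMeasure S) : ℝ :=
  ⨆ ψ : M.Policy, M.discReward β ψ μ

/-- `φ` is an optimal decision rule of the `β`-discounted problem: the stationary policy
`(φ, φ, …)` attains the value function at every initial state. -/
def IsDiscountOptimal (M : MeanFieldModel S A 𝒵) (β : ℝ) (φ : M.DecisionRule) : Prop :=
  ∀ μ, M.discReward β (stationary φ) μ = M.discValue β μ

/-- Average reward of a policy. -/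
def avgReward (M : MeanFieldModel S A 𝒵) (ψ : M.Policy) (μ : ProbabilityMeasure S) : ℝ :=
  liminf (fun n : ℕ => (1 / (n : ℝ)) * ∑ k ∈ Finset.range n, M.expReward ψ μ k) atTop

/-- Maximal average reward. -/
def avgValue (M : MeanFieldModel S A 𝒵) (μ : ProbabilityMeasure S) : ℝ :=
  ⨆ ψ : M.Policy, M.avgReward ψ μ

/-- A policy is average-reward optimal if it attains the maximal average reward at every
initial state. -/
def IsAverageOptimal (M : MeanFieldModel S A 𝒵) (ψ : M.Policy) : Prop :=
  ∀ μ, M.avgReward ψ μ = M.avgValue μ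

/-- The expression `r̃(μ, Q) + E[h(T̃(μ, Q, Z⁰))]`, with values in the extended reals since `h`
need not be bounded below. -/
def avgBellman (M : MeanFieldModel S A 𝒵) (h : ProbabilityMeasure S → ℝ)
    (μ : ProbabilityMeasure S) (Q : ProbabilityMeasure M.graph) : EReal :=
  (M.limitReward μ Q : EReal)
    + extExpectation (M.lawZ0 : Measure 𝒵) fun z0 => h (M.limitTransition μ Q z0)

/-- `φ` is a maximizer: `φ(μ)` attains `sup_{Q ∈ D̃(μ)} {r̃(μ, Q) + E[h(T̃(μ, Q, Z⁰))]}` for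
every `μ`. -/
def IsMaximizer (M : MeanFieldModel S A 𝒵) (h : ProbabilityMeasure S → ℝ)
    (φ : M.DecisionRule) : Prop :=
  ∀ μ, M.avgBellman h μ (φ.1 μ) = ⨆ Q ∈ M.admissible μ, M.avgBellman h μ Q

/-- The ergodicity condition with reference distribution `ν`: the relative value functions
`J^β(μ) - J^β(ν)` are bounded above uniformly in `μ` and below by a function of `μ`, uniformly
in `β` close to `1`. -/
def Ergodic (M : MeanFieldModel S A 𝒵) (ν : ProbabilityMeasure S) : Prop :=
  ∃ L : ℝ, 0 < L ∧ ∃ βbar ∈ Ioo (0 : ℝ) 1, ∃ m : ProbabilityMeasure S → ℝ,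
    ∀ μ, ∀ β ∈ Ico βbar 1,
      m μ ≤ M.discValue β μ - M.discValue β ν ∧ M.discValue β μ - M.discValue β ν ≤ L

section Topological

variable [TopologicalSpace S] [OpensMeasurableSpace S] [TopologicalSpace A] [TopologicalSpace 𝒵]

/-- The set of admissible state-action pairs is compact. -/
def CompactGraph (M : MeanFieldModel S A 𝒵) : Prop := IsCompact M.graph

/-- `x ↦ D(x)` is upper semicontinuous: if `x_n → x` and `a_n ∈ D(x_n)` then `(a_n)` has an
accumulation point in `D(x)`. -/
def UpperSemicontinuousConstraint (M : MeanFieldModel S A 𝒵) : Prop :=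
  ∀ (x : S) (xs : ℕ → S) (as : ℕ → A), Tendsto xs atTop (𝓝 x) → (∀ n, as n ∈ M.D (xs n)) →
    ∃ a ∈ M.D x, MapClusterPt a atTop as

/-- The reward is continuous, `ProbabilityMeasure S` carrying the topology of weak
convergence. -/
def ContinuousReward (M : MeanFieldModel S A 𝒵) : Prop :=
  Continuous fun p : S × A × ProbabilityMeasure S => M.r p.1 p.2.1 p.2.2

/-- The disturbance space is compact and the transition function is jointly continuous. -/
def ContinuousTransition (M : MeanFieldModel S A 𝒵) : Prop :=
  CompactSpace 𝒵 ∧ Continuous fun p : S × A × ProbabilityMeasure S × 𝒵 × 𝒵 =>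
    M.T p.1 p.2.1 p.2.2.1 p.2.2.2.1 p.2.2.2.2

end Topological

end MeanFieldModel

end

/-! The state is the first marginal of the action `Q`, so the whole model is written in terms of
`Q`: admissibility is a fibre of the continuous map `firstMargin` on the compact metrizable space of
probability measures on the graph. Rewards are replaced by costs `C - M.reward Q ≥ 0` with values in
`ℝ≥0∞`. Integrals then always exist, and monotone convergence and Fatou apply to lower
semicontinuous functions that may be unbounded.

For fixed `β`, value iteration from `0` increases to a lower semicontinuous solution of the
optimality equation (`exists_lowerSemicontinuous_bellman`). Its minimizers can be selected
measurably, and `discount_optimality` identifies it with the discounted value.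

Then the discount vanishes. Choose `β k ↑ 1` along which `(1 - β k) J(ν)` tends to the limsup `ρ`.
The relative costs `L - (J(μ) - J(ν))` are nonnegative and, for each `μ`, bounded in `k`; hence
their relaxed lower limit `g` is finite and lower semicontinuous, and `h = L - g`. Along indices and
states approaching `μ` that realize `g μ`, compactness gives a limit `Q` of the discounted optimal
actions, and Fatou carries the discounted equation to the optimality inequality at `Q`
(`exists_limitPoint_optimality_inequality`).

A stationary rule satisfying this inequality everywhere earns at least `ρ`, by iteration
(`le_avgReward_stationary`); no policy earns more, by an Abelian comparison (`avgReward_le`). For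
the last claim the cost is minimized only over limit points of discounted optimal actions. They form
a closed set containing the `Q` above, so measurable selection applies and the inequality survives.
-/

noncomputable section

/-! ### Borel structure of the weak topology. -/

section WeakTopology

variable {X : Type*} [TopologicalSpace X]

lemma secondCountableTopology_of_compact_metrizable [CompactSpace X]
    [TopologicalSpace.MetrizableSpace X] : SecondCountableTopology X := by
  let _ := TopologicalSpace.metrizableSpaceMetric X
  infer_instance

variable [MeasurableSpace X]

/-- Exhibits a subbasis made of preimages under integration of test functions, from which the Borel
sets can be generated. -/
lemma ProbabilityMeasure.topology_eq_iInf_induced_lintegral [OpensMeasurableSpace X] :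
    (ProbabilityMeasure.instTopologicalSpace : TopologicalSpace (ProbabilityMeasure X)) =
      ⨅ f : BoundedContinuousFunction X NNReal,
        TopologicalSpace.induced
          (fun μ : ProbabilityMeasure X => ∫⁻ x, f x ∂(μ : Measure X)) inferInstance := by
  refine TopologicalSpace.ext_nhds fun μ => ?_
  have h : ∀ f : BoundedContinuousFunction X NNReal,
      @nhds _ (TopologicalSpace.induced
        (fun μ : ProbabilityMeasure X => ∫⁻ x, f x ∂(μ : Measure X)) inferInstance) μ =
      comap (fun μ : ProbabilityMeasure X => ∫⁻ x, f x ∂(μ : Measure X))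
        (𝓝 (∫⁻ x, f x ∂(μ : Measure X))) := fun f => nhds_induced _ _
  rw [nhds_iInf, iInf_congr h]
  refine le_antisymm ?_ ?_
  · refine le_iInf fun f => ?_
    rw [← tendsto_iff_comap]
    exact ProbabilityMeasure.tendsto_iff_forall_lintegral_tendsto.1 (tendsto_id (x := 𝓝 μ)) f
  · refine tendsto_id'.1 (ProbabilityMeasure.tendsto_iff_forall_lintegral_tendsto.2 fun f => ?_)
    exact tendsto_comap.mono_left (iInf_le _ f)

variable [BorelSpace X] [TopologicalSpace.MetrizableSpace X]

/-- By the portmanteau theorem the mass of an open set is lower semicontinuous in the measure, and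
open sets form a generating π-system. -/
lemma ProbabilityMeasure.measurableSpace_le_borel :
    (inferInstance : MeasurableSpace (ProbabilityMeasure X)) ≤ borel _ := by
  have h : Measurable[borel (ProbabilityMeasure X)]
      fun μ : ProbabilityMeasure X => (μ : Measure X) := by
    let _ : MeasurableSpace (ProbabilityMeasure X) := borel _
    have : BorelSpace (ProbabilityMeasure X) := ⟨rfl⟩
    refine Measurable.measure_of_isPiSystem_of_isProbabilityMeasure
      BorelSpace.measurable_eq isPiSystem_isOpen ?_
    intro U hU
    refine (lowerSemicontinuous_iff_le_liminf.2 fun μ => ?_).measurable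
    exact ProbabilityMeasure.le_liminf_measure_open_of_tendsto (tendsto_id (x := 𝓝 μ)) hU
  exact measurable_iff_comap_le.1 h

/-- The weak topology is second countable here, so its Borel sets are generated by the subbasis;
each subbasic set is measurable because integrals are measurable in the measure. -/
instance ProbabilityMeasure.borelSpace_of_compact [CompactSpace X] : BorelSpace (ProbabilityMeasure X) := by
  refine ⟨le_antisymm ProbabilityMeasure.measurableSpace_le_borel ?_⟩
  have : SecondCountableTopology (ProbabilityMeasure X) :=
    have := secondCountableTopology_of_compact_metrizable (X := X)
    secondCountableTopology_of_compact_metrizable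
  have h := ProbabilityMeasure.topology_eq_iInf_induced_lintegral (X := X)
  rw [← generateFrom_iUnion_isOpen] at h
  rw [borel_eq_generateFrom_of_subbasis h]
  refine MeasurableSpace.generateFrom_le fun s hs => ?_
  obtain ⟨f, hf⟩ := mem_iUnion.1 hs
  obtain ⟨t, ht, rfl⟩ := isOpen_induced_iff.1 hf
  have hm : Measurable fun μ : ProbabilityMeasure X => ∫⁻ x, f x ∂(μ : Measure X) :=
    (Measure.measurable_lintegral (by fun_prop)).comp measurable_subtype_coe
  exact hm ht.measurableSet

end WeakTopology

/-! ### Measurable selection of maximizers. -/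

section MeasurableSelection

variable {E K : Type*} [TopologicalSpace K]

/-- The points of `F x` at which `g` is maximal over `F x`. -/
def argmaxOn (g : K → EReal) (F : E → Set K) (x : E) : Set K :=
  {k ∈ F x | ∀ k' ∈ F x, g k' ≤ g k}

lemma isClosed_argmaxOn {g : K → EReal} (hg : UpperSemicontinuous g) {F : E → Set K} {x : E}
    (hF : IsClosed (F x)) : IsClosed (argmaxOn g F x) := by
  have : argmaxOn g F x = F x ∩ ⋂ k' ∈ F x, g ⁻¹' Ici (g k') := by
    ext k; simp [argmaxOn]
  rw [this]
  exact hF.inter (isClosed_biInter fun k' _ => hg.isClosed_preimage _)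

variable [MeasurableSpace E]

/-- A set-valued map is weakly measurable if the set of points at which it meets a given closed
set is measurable. -/
def HitsMeasurably (F : E → Set K) : Prop :=
  ∀ C : Set K, IsClosed C → MeasurableSet {x | (F x ∩ C).Nonempty}

variable [CompactSpace K]

lemma exists_maximal_of_upperSemicontinuous {g : K → EReal} (hg : UpperSemicontinuous g)
    {s : Set K} (hs : IsClosed s) (hne : s.Nonempty) : ∃ k ∈ s, ∀ k' ∈ s, g k' ≤ g k := by
  obtain ⟨k, hk, h⟩ := (hg.upperSemicontinuousOn s).exists_isMaxOn hne hs.isCompact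
  exact ⟨k, hk, fun k' hk' => h hk'⟩

/-- The argmax set meets `C` exactly when `g` has the same maximum on `F x ∩ C` as on `F x`. Maxima
are attained by compactness, so it suffices to compare rational superlevel sets, countably many. -/
lemma HitsMeasurably.argmaxOn {g : K → EReal} (hg : UpperSemicontinuous g) {F : E → Set K}
    (hcl : ∀ x, IsClosed (F x)) (hF : HitsMeasurably F) :
    HitsMeasurably (argmaxOn g F) := by
  intro C hC
  have hq : ∀ q : ℚ, IsClosed (g ⁻¹' Ici ((q : ℝ) : EReal)) := fun q => hg.isClosed_preimage _
  have key : {x | (_root_.argmaxOn g F x ∩ C).Nonempty} = {x | (F x ∩ C).Nonempty} ∩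
      ⋂ q : ℚ, ({x | (F x ∩ g ⁻¹' Ici ((q : ℝ) : EReal)).Nonempty}ᶜ ∪
        {x | (F x ∩ (C ∩ g ⁻¹' Ici ((q : ℝ) : EReal))).Nonempty}) := by
    ext x
    simp only [mem_ofPred_eq, mem_inter_iff, mem_iInter, mem_union, mem_compl_iff]
    constructor
    · rintro ⟨k, ⟨hk, hmax⟩, hkC⟩
      refine ⟨⟨k, hk, hkC⟩, fun q => ?_⟩
      by_cases h : (F x ∩ g ⁻¹' Ici ((q : ℝ) : EReal)).Nonempty
      · obtain ⟨k', hk', hq'⟩ := h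
        exact Or.inr ⟨k, hk, hkC, le_trans hq' (hmax k' hk')⟩
      · exact Or.inl h
    · rintro ⟨hne, h⟩
      obtain ⟨k, ⟨hk, hkC⟩, hmax⟩ :=
        exists_maximal_of_upperSemicontinuous hg ((hcl x).inter hC) hne
      refine ⟨k, ⟨hk, fun k' hk' => ?_⟩, hkC⟩
      by_contra hlt
      obtain ⟨q, hq1, hq2⟩ := EReal.exists_rat_btwn_of_lt (not_le.1 hlt)
      rcases h q with h | ⟨k'', hk'', hC'', hq''⟩
      · exact h ⟨k', hk', hq2.le⟩
      · exact absurd (le_trans hq'' (hmax k'' ⟨hk'', hC''⟩)) (not_le.2 hq1)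
  rw [key]
  exact (hF C hC).inter (MeasurableSet.iInter fun q =>
    (hF _ (hq q)).compl.union (hF _ (hC.inter (hq q))))

variable [TopologicalSpace.MetrizableSpace K] [MeasurableSpace K] [BorelSpace K]

/-- Measurable selection for closed-valued weakly measurable maps into a compact metrizable
space. -/
theorem HitsMeasurably.exists_measurable_selection {F : E → Set K}
    (hcl : ∀ x, IsClosed (F x)) (hne : ∀ x, (F x).Nonempty) (hF : HitsMeasurably F) :
    ∃ φ : E → K, Measurable φ ∧ ∀ x, φ x ∈ F x := by
  rcases isEmpty_or_nonempty E with hE | ⟨⟨x₀⟩⟩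
  · exact ⟨fun x => hE.elim x, measurable_of_empty _, fun x => hE.elim x⟩
  let _ := TopologicalSpace.metrizableSpaceMetric K
  have : Nonempty K := ⟨(hne x₀).some⟩
  let d : ℕ → K := TopologicalSpace.denseSeq K
  let f : ℕ → K → EReal := fun n k => ((dist k (d n) : ℝ) : EReal)
  have hf : ∀ n, UpperSemicontinuous (f n) := fun n =>
    (continuous_coe_real_ereal.comp (by fun_prop : Continuous fun k => dist k (d n))
      ).upperSemicontinuous
  -- Maximize the distances to the points of a dense sequence one after the other. Two points in all
  -- the resulting sets have the same distance to every dense point, hence coincide.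
  let G : ℕ → E → Set K := fun n => Nat.rec F (fun n H => _root_.argmaxOn (f n) H) n
  have hG : ∀ n, (∀ x, IsClosed (G n x)) ∧ (∀ x, (G n x).Nonempty) ∧ HitsMeasurably (G n) := by
    intro n
    induction n with
    | zero => exact ⟨hcl, hne, hF⟩
    | succ n ih =>
      refine ⟨fun x => isClosed_argmaxOn (hf n) (ih.1 x), fun x => ?_, ih.2.2.argmaxOn (hf n) ih.1⟩
      obtain ⟨k, hk, h⟩ := exists_maximal_of_upperSemicontinuous (hf n) (ih.1 x) (ih.2.1 x)
      exact ⟨k, hk, h⟩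
  have hmono : ∀ n x, G (n + 1) x ⊆ G n x := fun n x k hk => hk.1
  have hinter : ∀ x (C : Set K), IsClosed C → (∀ n, (G n x ∩ C).Nonempty) →
      ((⋂ n, G n x) ∩ C).Nonempty := by
    intro x C hC h
    have := IsCompact.nonempty_iInter_of_sequence_nonempty_isCompact_isClosed
      (fun n => G n x ∩ C) (fun n => inter_subset_inter_left _ (hmono n x)) h
      (((hG 0).1 x).inter hC).isCompact (fun n => ((hG n).1 x).inter hC)
    rwa [← iInter_inter] at this
  have huniq : ∀ x, ∀ k ∈ ⋂ n, G n x, ∀ k' ∈ ⋂ n, G n x, k = k' := by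
    intro x k hk k' hk'
    rw [mem_iInter] at hk hk'
    have hd : ∀ n, dist k (d n) = dist k' (d n) := fun n => EReal.coe_injective
      (le_antisymm ((hk' (n + 1)).2 k (hk n)) ((hk (n + 1)).2 k' (hk' n)))
    have heq : (fun y => dist k y) = fun y => dist k' y :=
      Continuous.ext_on (TopologicalSpace.denseRange_denseSeq K) (by fun_prop) (by fun_prop)
        (by rintro _ ⟨n, rfl⟩; exact hd n)
    have := congrFun heq k'
    exact dist_eq_zero.1 (by simpa using this)
  have hex : ∀ x, ∃ k, k ∈ ⋂ n, G n x := fun x => by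
    obtain ⟨k, hk, -⟩ := hinter x univ isClosed_univ (by simpa using fun n => (hG n).2.1 x)
    exact ⟨k, hk⟩
  choose φ hφ using hex
  refine ⟨φ, measurable_of_isClosed fun C hC => ?_, fun x => mem_iInter.1 (hφ x) 0⟩
  have : φ ⁻¹' C = ⋂ n, {x | (G n x ∩ C).Nonempty} := by
    ext x
    simp only [mem_preimage, mem_iInter, mem_ofPred_eq]
    refine ⟨fun h n => ⟨φ x, mem_iInter.1 (hφ x) n, h⟩, fun h => ?_⟩
    obtain ⟨k, hk, hkC⟩ := hinter x C hC h
    rwa [huniq x _ (hφ x) _ hk]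
  rw [this]
  exact MeasurableSet.iInter fun n => (hG n).2.2 C hC

/-- Measurable selection of maximizers of an upper semicontinuous function over the fibres of a
continuous map, restricted to a closed set. -/
theorem exists_measurable_argmax_fiber [TopologicalSpace E] [T2Space E] [BorelSpace E]
    {p : K → E} (hp : Continuous p) {s : Set K} (hs : IsClosed s) (hps : ∀ x, ∃ k ∈ s, p k = x)
    {g : K → EReal} (hg : UpperSemicontinuous g) :
    ∃ φ : E → K, Measurable φ ∧
      ∀ x, φ x ∈ s ∧ p (φ x) = x ∧ ∀ k ∈ s, p k = x → g k ≤ g (φ x) := by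
  let F : E → Set K := fun x => s ∩ p ⁻¹' {x}
  have hcl : ∀ x, IsClosed (F x) := fun x => hs.inter (isClosed_singleton.preimage hp)
  have hF : HitsMeasurably F := fun C hC => by
    have : {x | (F x ∩ C).Nonempty} = p '' (s ∩ C) := by
      ext x
      constructor
      · rintro ⟨k, ⟨hk, hx⟩, hkC⟩
        exact ⟨k, ⟨hk, hkC⟩, hx⟩
      · rintro ⟨k, ⟨hk, hkC⟩, hx⟩
        exact ⟨k, ⟨hk, hx⟩, hkC⟩
    rw [this]
    exact ((hs.inter hC).isCompact.image hp).isClosed.measurableSet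
  obtain ⟨φ, hφ, h⟩ := (hF.argmaxOn hg hcl).exists_measurable_selection
    (fun x => isClosed_argmaxOn hg (hcl x)) fun x => by
      obtain ⟨k, hk, hx⟩ := hps x
      exact exists_maximal_of_upperSemicontinuous hg (hcl x) ⟨k, hk, hx⟩
  exact ⟨φ, hφ, fun x => ⟨(h x).1.1, (h x).1.2, fun k hk hx => (h x).2 k ⟨hk, hx⟩⟩⟩

end MeasurableSelection

/-! ### Joint continuity of integrals. -/

section IntegralContinuity

variable {X Y : Type*} [TopologicalSpace X] [MeasurableSpace X] [OpensMeasurableSpace X]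
  [TopologicalSpace Y]

/-- Weak convergence handles the integrand frozen at its limit; the remaining error is at most the
sup-norm distance of the integrands, as all measures have mass one. -/
lemma continuous_integral_boundedContinuousFunction :
    Continuous fun q : BoundedContinuousFunction X ℝ × ProbabilityMeasure X =>
      ∫ x, q.1 x ∂(q.2 : Measure X) := by
  refine continuous_iff_continuousAt.2 fun q => ?_
  have h1 : Tendsto (fun q' : BoundedContinuousFunction X ℝ × ProbabilityMeasure X =>
      ∫ x, q.1 x ∂(q'.2 : Measure X)) (𝓝 q) (𝓝 (∫ x, q.1 x ∂(q.2 : Measure X))) :=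
    ProbabilityMeasure.tendsto_iff_forall_integral_tendsto.1 (continuous_snd.tendsto q) q.1
  have h2 : Tendsto (fun q' : BoundedContinuousFunction X ℝ × ProbabilityMeasure X =>
      ∫ x, (q'.1 - q.1) x ∂(q'.2 : Measure X)) (𝓝 q) (𝓝 0) := by
    have h3 : Tendsto (fun q' : BoundedContinuousFunction X ℝ × ProbabilityMeasure X =>
        ‖q'.1 - q.1‖) (𝓝 q) (𝓝 0) := by
      have : Continuous fun q' : BoundedContinuousFunction X ℝ × ProbabilityMeasure X =>
        ‖q'.1 - q.1‖ := by fun_prop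
      simpa using this.tendsto q
    exact squeeze_zero_norm (fun q' =>
      BoundedContinuousFunction.norm_integral_le_norm (q'.2 : Measure X) _) h3
  have h4 := h1.add h2
  rw [add_zero] at h4
  refine h4.congr fun q' => ?_
  rw [← integral_add (q.1.integrable _) ((q'.1 - q.1).integrable _)]
  simp

/-- Over a compact space currying makes `y ↦ f (y, ·)` continuous in the sup norm, which reduces to
the preceding lemma. -/
lemma Continuous.integral_probabilityMeasure [CompactSpace X] {f : Y × X → ℝ} (hf : Continuous f) :
    Continuous fun q : Y × ProbabilityMeasure X => ∫ x, f (q.1, x) ∂(q.2 : Measure X) := by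
  let F : C(Y, C(X, ℝ)) := ContinuousMap.curry ⟨f, hf⟩
  have h : Continuous fun q : Y × ProbabilityMeasure X =>
      (BoundedContinuousFunction.mkOfCompact (F q.1), q.2) :=
    (((ContinuousMap.isometryEquivBoundedOfCompact X ℝ).continuous.comp F.continuous).comp
      continuous_fst).prodMk continuous_snd
  exact continuous_integral_boundedContinuousFunction.comp h

end IntegralContinuity

/-! ### The limit model in terms of actions. -/

namespace MeanFieldModel

variable {S A 𝒵 : Type*} [MeasurableSpace S] [MeasurableSpace A] [MeasurableSpace 𝒵]

/-- The reward of the limit problem as a function of the action alone. -/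
def reward (M : MeanFieldModel S A 𝒵) (Q : ProbabilityMeasure M.graph) : ℝ :=
  M.limitReward (M.firstMargin Q) Q

/-- The transition function of the limit problem as a function of the action and the common
noise. -/
def next (M : MeanFieldModel S A 𝒵) (Q : ProbabilityMeasure M.graph) (z : 𝒵) :
    ProbabilityMeasure S :=
  M.limitTransition (M.firstMargin Q) Q z

lemma exists_bound_reward (M : MeanFieldModel S A 𝒵) : ∃ C : ℝ, 0 ≤ C ∧ ∀ Q, |M.reward Q| ≤ C := by
  obtain ⟨C, hC⟩ := M.bounded_r
  refine ⟨|C|, abs_nonneg C, fun Q => ?_⟩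
  have := norm_integral_le_of_norm_le_const (μ := (Q : Measure M.graph))
    (f := fun p : M.graph => M.r p.1.1 p.1.2 (M.firstMargin Q)) (C := |C|)
    (Eventually.of_forall fun p => (hC _ _ _).trans (le_abs_self C))
  simpa [reward, limitReward] using this

/-- Pushing `μ` forward along the graph of the selector gives an admissible action. -/
lemma exists_firstMargin_eq (M : MeanFieldModel S A 𝒵) (μ : ProbabilityMeasure S) :
    ∃ Q, M.firstMargin Q = μ := by
  obtain ⟨f, hf, hD⟩ := M.exists_selector
  have hm : Measurable fun x => (⟨(x, f x), show (x, f x) ∈ M.graph from hD x⟩ : M.graph) :=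
    (measurable_id.prodMk hf).subtype_mk
  refine ⟨μ.map hm.aemeasurable, ?_⟩
  apply Subtype.ext
  simp only [firstMargin, ProbabilityMeasure.val_eq_to_measure, ProbabilityMeasure.toMeasure_map]
  exact (Measure.map_map (measurable_fst.comp measurable_subtype_coe) hm).trans Measure.map_id

section Topological

variable [TopologicalSpace S] [BorelSpace S] [TopologicalSpace A] [BorelSpace A]
    [SecondCountableTopology A]

lemma continuous_firstMargin (M : MeanFieldModel S A 𝒵) : Continuous M.firstMargin :=
  ProbabilityMeasure.continuous_map (continuous_fst.comp continuous_subtype_val)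

lemma continuous_reward (M : MeanFieldModel S A 𝒵) [CompactSpace M.graph]
    (hr : M.ContinuousReward) : Continuous M.reward := by
  have h : Continuous fun q : ProbabilityMeasure S × M.graph => M.r q.2.1.1 q.2.1.2 q.1 :=
    hr.comp (f := fun q : ProbabilityMeasure S × M.graph => (q.2.1.1, q.2.1.2, q.1))
      (by fun_prop)
  exact (Continuous.integral_probabilityMeasure h).comp
    (M.continuous_firstMargin.prodMk continuous_id)

variable [TopologicalSpace.MetrizableSpace S] [SecondCountableTopology S]
    [TopologicalSpace.MetrizableSpace A]
    [TopologicalSpace 𝒵] [TopologicalSpace.MetrizableSpace 𝒵]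
    [SecondCountableTopology 𝒵] [BorelSpace 𝒵]

lemma continuous_next (M : MeanFieldModel S A 𝒵) [CompactSpace M.graph]
    (hT : M.ContinuousTransition) :
    Continuous fun q : ProbabilityMeasure M.graph × 𝒵 => M.next q.1 q.2 := by
  have : CompactSpace 𝒵 := hT.1
  refine continuous_iff_continuousAt.2 fun q => ?_
  refine ProbabilityMeasure.tendsto_iff_forall_integral_tendsto.2 fun f => ?_
  have h1 : Continuous fun q : (ProbabilityMeasure S × 𝒵) × (M.graph × 𝒵) =>
      f (M.T q.2.1.1.1 q.2.1.1.2 q.1.1 q.2.2 q.1.2) :=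
    f.continuous.comp (hT.2.comp (f := fun q : (ProbabilityMeasure S × 𝒵) × (M.graph × 𝒵) =>
      (q.2.1.1.1, q.2.1.1.2, q.1.1, q.2.2, q.1.2)) (by fun_prop))
  have h2 : Continuous fun q : ProbabilityMeasure M.graph × 𝒵 =>
      ((M.firstMargin q.1, q.2), q.1.prod M.lawZ) :=
    ((M.continuous_firstMargin.comp continuous_fst).prodMk continuous_snd).prodMk
      (ProbabilityMeasure.continuous_prod.comp (continuous_fst.prodMk continuous_const))
  have h3 := ((Continuous.integral_probabilityMeasure h1).comp h2).tendsto q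
  have h4 : ∀ q : ProbabilityMeasure M.graph × 𝒵, ∫ x, f x ∂(M.next q.1 q.2 : Measure S) =
      ∫ x : M.graph × 𝒵, f (M.T x.1.1.1 x.1.1.2 (M.firstMargin q.1) x.2 q.2)
        ∂(q.1.prod M.lawZ : Measure (M.graph × 𝒵)) := by
    intro q
    simp only [next, limitTransition, ProbabilityMeasure.toMeasure_map]
    exact integral_map (M.measurable_T_slice _ _).aemeasurable
      f.continuous.aestronglyMeasurable
  simp only [h4]
  exact h3

end Topological

end MeanFieldModel

/-! ### The discounted optimality equation by value iteration. -/

section ValueIteration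

variable {E K Z : Type*} [MeasurableSpace Z]

/-- Cost of an action `k` in a discounted problem: the stage cost plus the discounted expectation
of the terminal cost `V`. -/
def bellmanCost (P : Measure Z) (τ : K → Z → E) (c : K → ℝ≥0∞) (β : ℝ≥0∞) (V : E → ℝ≥0∞)
    (k : K) : ℝ≥0∞ :=
  c k + β * ∫⁻ z, V (τ k z) ∂P

variable {P : Measure Z} {τ : K → Z → E} {c : K → ℝ≥0∞} {β : ℝ≥0∞}

lemma bellmanCost_mono {V V' : E → ℝ≥0∞} (h : ∀ x, V x ≤ V' x) (k : K) :
    bellmanCost P τ c β V k ≤ bellmanCost P τ c β V' k := by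
  unfold bellmanCost
  gcongr
  exact h _

variable [TopologicalSpace E] [TopologicalSpace K]
  [TopologicalSpace Z] [OpensMeasurableSpace Z]

/-- Fatou along sequences, which suffice to test closed sublevel sets in a first countable space. -/
lemma lowerSemicontinuous_lintegral_comp [FirstCountableTopology K] {V : E → ℝ≥0∞}
    (hV : LowerSemicontinuous V) (hτ : Continuous fun q : K × Z => τ q.1 q.2) :
    LowerSemicontinuous fun k => ∫⁻ z, V (τ k z) ∂P := by
  have hz : ∀ k, Measurable fun z => V (τ k z) := fun k =>
    (LowerSemicontinuous.comp hV (hτ.comp (by fun_prop : Continuous fun z : Z => (k, z)))).measurable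
  refine lowerSemicontinuous_iff_isClosed_preimage.2 fun a => ?_
  refine IsSeqClosed.isClosed fun u k hu huk => ?_
  have h : ∀ z, V (τ k z) ≤ liminf (fun n => V (τ (u n) z)) atTop := fun z => by
    have h1 : Tendsto (fun n => τ (u n) z) atTop (𝓝 (τ k z)) :=
      (hτ.tendsto (k, z)).comp (huk.prodMk_nhds tendsto_const_nhds)
    exact (lowerSemicontinuous_iff_le_liminf.1 hV _).trans (h1.liminf_le_liminf_comp)
  calc ∫⁻ z, V (τ k z) ∂P ≤ ∫⁻ z, liminf (fun n => V (τ (u n) z)) atTop ∂P := lintegral_mono h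
    _ ≤ liminf (fun n => ∫⁻ z, V (τ (u n) z) ∂P) atTop := lintegral_liminf_le fun n => hz _
    _ ≤ liminf (fun _ => a) atTop := liminf_le_liminf (Eventually.of_forall hu)
    _ = a := liminf_const a

lemma lowerSemicontinuous_bellmanCost [FirstCountableTopology K] {V : E → ℝ≥0∞}
    (hV : LowerSemicontinuous V) (hτ : Continuous fun q : K × Z => τ q.1 q.2)
    (hc : LowerSemicontinuous c) (hβ : β ≠ ⊤) :
    LowerSemicontinuous (bellmanCost P τ c β V) := by
  refine hc.add ?_
  exact (ENNReal.continuous_const_mul hβ).comp_lowerSemicontinuous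
    (lowerSemicontinuous_lintegral_comp hV hτ) (fun a b h => mul_le_mul_right h β)

variable [CompactSpace K] [T2Space E]

/-- The lower semicontinuous solution of the discounted optimality equation. -/
theorem exists_lowerSemicontinuous_bellman [FirstCountableTopology K] {p : K → E}
    (hp : Continuous p) (hps : ∀ x, ∃ k, p k = x) (hτ : Continuous fun q : K × Z => τ q.1 q.2)
    [IsProbabilityMeasure P] (hc : LowerSemicontinuous c) {b B : ℝ≥0∞} (hcb : ∀ k, c k ≤ b)
    (hβ : β ≠ ⊤) (hB : b + β * B ≤ B) :
    ∃ V : E → ℝ≥0∞, LowerSemicontinuous V ∧ (∀ x, V x ≤ B) ∧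
      (∀ k, V (p k) ≤ bellmanCost P τ c β V k) ∧
      ∀ x, ∃ k, p k = x ∧ bellmanCost P τ c β V k ≤ V x := by
  let Φ : (E → ℝ≥0∞) → E → ℝ≥0∞ := fun V x => ⨅ k, ⨅ _ : p k = x, bellmanCost P τ c β V k
  have hΦle : ∀ V k, Φ V (p k) ≤ bellmanCost P τ c β V k := fun V k =>
    iInf₂_le (f := fun k' (_ : p k' = p k) => bellmanCost P τ c β V k') k rfl
  have hΦatt : ∀ V, LowerSemicontinuous V → ∀ x, ∃ k, p k = x ∧
      bellmanCost P τ c β V k = Φ V x := by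
    intro V hV x
    obtain ⟨k, hk, hmin⟩ := ((lowerSemicontinuous_bellmanCost (P := P) hV hτ hc hβ
      ).lowerSemicontinuousOn (p ⁻¹' {x})).exists_isMinOn (hps x)
      (isClosed_singleton.preimage hp).isCompact
    exact ⟨k, hk, le_antisymm (le_iInf₂ fun k' hk' => hmin hk') (iInf₂_le k hk)⟩
  have hΦlsc : ∀ V, LowerSemicontinuous V → LowerSemicontinuous (Φ V) := by
    intro V hV
    refine lowerSemicontinuous_iff_isClosed_preimage.2 fun a => ?_
    -- Since the infimum is attained, a sublevel set downstairs is the image of a compact sublevel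
    -- set upstairs.
    have : Φ V ⁻¹' Iic a = p '' (bellmanCost P τ c β V ⁻¹' Iic a) := by
      ext x
      constructor
      · intro hx
        obtain ⟨k, hk, h⟩ := hΦatt V hV x
        exact ⟨k, h.trans_le hx, hk⟩
      · rintro ⟨k, hk, rfl⟩
        exact (hΦle V k).trans hk
    rw [this]
    exact ((lowerSemicontinuous_iff_isClosed_preimage.1
      (lowerSemicontinuous_bellmanCost (P := P) hV hτ hc hβ) a).isCompact.image hp).isClosed
  let v : ℕ → E → ℝ≥0∞ := fun n => Φ^[n] 0
  have hv : ∀ n, v (n + 1) = Φ (v n) := fun n => Function.iterate_succ_apply' Φ n 0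
  have hΦmono : ∀ V V' : E → ℝ≥0∞, V ≤ V' → Φ V ≤ Φ V' := fun V V' h x =>
    iInf₂_mono fun k _ => bellmanCost_mono h k
  have hmono : Monotone v := by
    refine monotone_nat_of_le_succ fun n => ?_
    induction n with
    | zero => exact fun x => zero_le
    | succ n ih => rw [hv n, hv (n + 1)]; exact hΦmono _ _ ih
  have hlsc : ∀ n, LowerSemicontinuous (v n) := by
    intro n
    induction n with
    | zero => exact lowerSemicontinuous_const
    | succ n ih => rw [hv n]; exact hΦlsc _ ih
  have hle : ∀ n x, v n x ≤ B := by
    intro n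
    induction n with
    | zero => exact fun x => zero_le
    | succ n ih =>
      intro x
      obtain ⟨k, rfl⟩ := hps x
      rw [hv n]
      refine (hΦle _ k).trans (le_trans ?_ hB)
      unfold bellmanCost
      gcongr
      · exact hcb k
      · refine (lintegral_mono fun z => ih _).trans ?_
        simp
  let V : E → ℝ≥0∞ := fun x => ⨆ n, v n x
  -- Monotone convergence exchanges the supremum over iterates with the expectation.
  have hVlim : ∀ k, bellmanCost P τ c β V k = ⨆ n, bellmanCost P τ c β (v n) k := by
    intro k
    have hz : ∀ n, Measurable fun z => v n (τ k z) := fun n =>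
      (LowerSemicontinuous.comp (hlsc n) (hτ.comp (by fun_prop : Continuous fun z : Z => (k, z)))).measurable
    simp only [bellmanCost, V]
    rw [lintegral_iSup hz (fun m n h z => hmono h _), ENNReal.mul_iSup, ENNReal.add_iSup]
  refine ⟨V, lowerSemicontinuous_iSup hlsc, fun x => iSup_le fun n => hle n x, fun k => ?_,
    fun x => ?_⟩
  · rw [hVlim]
    refine iSup_le fun n => ?_
    refine (hmono n.le_succ (p k)).trans ?_
    rw [hv n]
    exact (hΦle _ k).trans (le_iSup (fun n => bellmanCost P τ c β (v n) k) n)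
  -- The actions over `x` whose cost at every finite stage is at most `V x` form nested nonempty
  -- compact sets; a common point attains the equation in the limit.
  · let F : ℕ → Set K := fun n => p ⁻¹' {x} ∩ bellmanCost P τ c β (v n) ⁻¹' Iic (V x)
    have hFcl : ∀ n, IsClosed (F n) := fun n => (isClosed_singleton.preimage hp).inter
      (lowerSemicontinuous_iff_isClosed_preimage.1
        (lowerSemicontinuous_bellmanCost (hlsc n) hτ hc hβ) _)
    obtain ⟨k, hk⟩ := IsCompact.nonempty_iInter_of_sequence_nonempty_isCompact_isClosed F
      (fun n k hk => ⟨hk.1, (bellmanCost_mono (hmono n.le_succ) k).trans hk.2⟩)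
      (fun n => by
        obtain ⟨k, hk, h⟩ := hΦatt (v n) (hlsc n) x
        refine ⟨k, hk, ?_⟩
        rw [mem_preimage, h, ← hv n]
        exact le_iSup (fun n => v n x) (n + 1))
      (hFcl 0).isCompact hFcl
    rw [mem_iInter] at hk
    refine ⟨k, (hk 0).1, ?_⟩
    rw [hVlim]
    exact iSup_le fun n => (hk n).2

end ValueIteration

/-! ### The controlled process and its noise. -/

namespace MeanFieldModel

variable {S A 𝒵 : Type*} [MeasurableSpace S] [MeasurableSpace A] [MeasurableSpace 𝒵]
  (M : MeanFieldModel S A 𝒵)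

instance isProbabilityMeasure_noiseLaw : IsProbabilityMeasure M.noiseLaw := by
  unfold noiseLaw; infer_instance

/-- The action taken at time `n` under the policy `ψ`. -/
def action (ψ : M.Policy) (μ : ProbabilityMeasure S) (ω : ℕ → 𝒵) (n : ℕ) :
    ProbabilityMeasure M.graph :=
  (ψ n).1 (M.state ψ μ ω n)

variable {M}

lemma firstMargin_decisionRule (φ : M.DecisionRule) (μ : ProbabilityMeasure S) :
    M.firstMargin (φ.1 μ) = μ := φ.2.2 μ

lemma firstMargin_action (ψ : M.Policy) (μ : ProbabilityMeasure S) (ω : ℕ → 𝒵) (n : ℕ) :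
    M.firstMargin (M.action ψ μ ω n) = M.state ψ μ ω n := (ψ n).2.2 _

lemma state_succ (ψ : M.Policy) (μ : ProbabilityMeasure S) (ω : ℕ → 𝒵) (n : ℕ) :
    M.state ψ μ ω (n + 1) = M.next (M.action ψ μ ω n) (ω n) := by
  rw [next, firstMargin_action]; rfl

lemma expReward_eq (ψ : M.Policy) (μ : ProbabilityMeasure S) (k : ℕ) :
    M.expReward ψ μ k = ∫ ω, M.reward (M.action ψ μ ω k) ∂M.noiseLaw := by
  unfold expReward reward
  simp only [firstMargin_action]
  rfl

/-- The state at time `n` depends only on the noises with index below `n`. This gives measurability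
in `ω`, and independence from `ω n`. -/
lemma exists_state_eq_comp_restrict
    (hnext : Measurable fun q : ProbabilityMeasure M.graph × 𝒵 => M.next q.1 q.2)
    (ψ : M.Policy) (μ : ProbabilityMeasure S) (n : ℕ) :
    ∃ f : (Finset.range n → 𝒵) → ProbabilityMeasure S, Measurable f ∧
      ∀ ω, M.state ψ μ ω n = f fun i => ω i := by
  induction n with
  | zero => exact ⟨fun _ => μ, measurable_const, fun ω => rfl⟩
  | succ n ih =>
    obtain ⟨f, hf, h⟩ := ih
    let e : Finset.range n → Finset.range (n + 1) := fun i =>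
      ⟨i, Finset.range_subset_range.2 n.le_succ i.2⟩
    refine ⟨fun w => M.next ((ψ n).1 (f fun i => w (e i)))
      (w ⟨n, Finset.self_mem_range_succ n⟩), ?_, fun ω => ?_⟩
    · refine hnext.comp (Measurable.prodMk ((ψ n).2.1.comp (hf.comp ?_)) (measurable_pi_apply _))
      exact measurable_pi_lambda _ fun i => measurable_pi_apply _
    · rw [state_succ, action, h]

lemma measurable_action
    (hnext : Measurable fun q : ProbabilityMeasure M.graph × 𝒵 => M.next q.1 q.2)
    (ψ : M.Policy) (μ : ProbabilityMeasure S) (n : ℕ) :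
    Measurable fun ω => M.action ψ μ ω n := by
  obtain ⟨f, hf, h⟩ := exists_state_eq_comp_restrict hnext ψ μ n
  simp only [action, h]
  exact (ψ n).2.1.comp (hf.comp (measurable_pi_lambda _ fun i => measurable_pi_apply _))

lemma map_action_noise
    (hnext : Measurable fun q : ProbabilityMeasure M.graph × 𝒵 => M.next q.1 q.2)
    (ψ : M.Policy) (μ : ProbabilityMeasure S) (n : ℕ) :
    M.noiseLaw.map (fun ω => (M.action ψ μ ω n, ω n)) =
      (M.noiseLaw.map fun ω => M.action ψ μ ω n).prod (M.lawZ0 : Measure 𝒵) := by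
  obtain ⟨f, hf, h⟩ := exists_state_eq_comp_restrict hnext ψ μ n
  have hi : ProbabilityTheory.iIndepFun (fun (i : ℕ) (ω : ℕ → 𝒵) => ω i) M.noiseLaw :=
    ProbabilityTheory.iIndepFun_infinitePi (X := fun _ z => z) (fun _ => measurable_id)
  have hi2 := (hi.indepFun_finset (Finset.range n) {n} (by simp)
    (fun i => measurable_pi_apply i)).comp (φ := fun w => (ψ n).1 (f w))
    (ψ := fun w => w ⟨n, Finset.mem_singleton_self n⟩) ((ψ n).2.1.comp hf)
    (measurable_pi_apply (X := fun _ => 𝒵) (⟨n, Finset.mem_singleton_self n⟩ : ({n} : Finset ℕ)))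
  have hX : (fun ω => M.action ψ μ ω n) =
      (fun w => (ψ n).1 (f w)) ∘ fun ω (i : Finset.range n) => ω i := by
    funext ω; simp [action, h]
  have hm := measurable_action hnext ψ μ n
  rw [hX] at hm
  have := (ProbabilityTheory.indepFun_iff_map_prod_eq_prod_map_map hm.aemeasurable
    (measurable_pi_apply n).aemeasurable).1 hi2
  rw [hX, show (fun ω => (M.action ψ μ ω n, ω n)) = _ from
    funext fun ω => congrArg (·, ω n) (congrFun hX ω)]
  refine this.trans ?_
  congr 1
  exact Measure.infinitePi_map_eval _ n

/-- The common noise of the next transition is independent of the current action. -/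
lemma lintegral_state_succ
    (hnext : Measurable fun q : ProbabilityMeasure M.graph × 𝒵 => M.next q.1 q.2)
    (ψ : M.Policy) (μ : ProbabilityMeasure S) (n : ℕ)
    {f : ProbabilityMeasure S → ℝ≥0∞} (hf : Measurable f) :
    ∫⁻ ω, f (M.state ψ μ ω (n + 1)) ∂M.noiseLaw =
      ∫⁻ ω, ∫⁻ z, f (M.next (M.action ψ μ ω n) z) ∂(M.lawZ0 : Measure 𝒵) ∂M.noiseLaw := by
  have hF : Measurable fun q : ProbabilityMeasure M.graph × 𝒵 => f (M.next q.1 q.2) :=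
    hf.comp hnext
  have hm := measurable_action hnext ψ μ n
  have h1 := lintegral_map (μ := M.noiseLaw) hF (hm.prodMk (measurable_pi_apply n))
  rw [map_action_noise hnext, lintegral_prod _ hF.aemeasurable,
    lintegral_map hF.lintegral_prod_right' hm] at h1
  simp only [state_succ]
  exact h1.symm

end MeanFieldModel

/-! ### Verification for discounted costs. -/

namespace MeanFieldModel

variable {S A 𝒵 : Type*} [MeasurableSpace S] [MeasurableSpace A] [MeasurableSpace 𝒵]
  {M : MeanFieldModel S A 𝒵}

/-- Expected cost over the first `n` stages, discounted by `b`, with terminal cost `V`. -/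
def truncatedCost (c : ProbabilityMeasure M.graph → ℝ≥0∞) (b : ℝ≥0∞)
    (V : ProbabilityMeasure S → ℝ≥0∞) (ψ : M.Policy) (μ : ProbabilityMeasure S) (n : ℕ) : ℝ≥0∞ :=
  ∑ k ∈ Finset.range n, b ^ k * ∫⁻ ω, c (M.action ψ μ ω k) ∂M.noiseLaw
    + b ^ n * ∫⁻ ω, V (M.state ψ μ ω n) ∂M.noiseLaw

section DynamicProgramming

variable {c : ProbabilityMeasure M.graph → ℝ≥0∞} {b : ℝ≥0∞} {V : ProbabilityMeasure S → ℝ≥0∞}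

lemma lintegral_bellmanCost_action
    (hnext : Measurable fun q : ProbabilityMeasure M.graph × 𝒵 => M.next q.1 q.2)
    (hc : Measurable c) (hV : Measurable V) (ψ : M.Policy) (μ : ProbabilityMeasure S) (n : ℕ) :
    ∫⁻ ω, bellmanCost (M.lawZ0 : Measure 𝒵) M.next c b V (M.action ψ μ ω n) ∂M.noiseLaw =
      ∫⁻ ω, c (M.action ψ μ ω n) ∂M.noiseLaw
        + b * ∫⁻ ω, V (M.state ψ μ ω (n + 1)) ∂M.noiseLaw := by
  have hm := measurable_action hnext ψ μ n
  have hF : Measurable fun q : ProbabilityMeasure M.graph × 𝒵 => V (M.next q.1 q.2) :=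
    hV.comp hnext
  unfold bellmanCost
  rw [lintegral_add_left (f := fun ω => c (M.action ψ μ ω n)) (hc.comp hm),
    lintegral_const_mul (f := fun ω => ∫⁻ z, V (M.next (M.action ψ μ ω n) z) ∂(M.lawZ0 : Measure 𝒵))
      _ (hF.lintegral_prod_right'.comp hm),
    lintegral_state_succ hnext ψ μ n hV]

lemma truncatedCost_succ
    (hnext : Measurable fun q : ProbabilityMeasure M.graph × 𝒵 => M.next q.1 q.2)
    (hc : Measurable c) (hV : Measurable V) (ψ : M.Policy) (μ : ProbabilityMeasure S) (n : ℕ) :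
    truncatedCost c b V ψ μ (n + 1) =
      ∑ k ∈ Finset.range n, b ^ k * ∫⁻ ω, c (M.action ψ μ ω k) ∂M.noiseLaw
        + b ^ n * ∫⁻ ω, bellmanCost (M.lawZ0 : Measure 𝒵) M.next c b V (M.action ψ μ ω n)
          ∂M.noiseLaw := by
  rw [truncatedCost, lintegral_bellmanCost_action hnext hc hV, Finset.sum_range_succ]
  ring

lemma truncatedCost_zero (ψ : M.Policy) (μ : ProbabilityMeasure S) :
    truncatedCost c b V ψ μ 0 = V μ := by
  simp [truncatedCost, state]

lemma truncatedCost_one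
    (hnext : Measurable fun q : ProbabilityMeasure M.graph × 𝒵 => M.next q.1 q.2)
    (hc : Measurable c) (hV : Measurable V) (ψ : M.Policy) (μ : ProbabilityMeasure S) :
    truncatedCost c b V ψ μ 1 =
      bellmanCost (M.lawZ0 : Measure 𝒵) M.next c b V ((ψ 0).1 μ) := by
  rw [truncatedCost_succ hnext hc hV]
  simp [action, state]

/-- Verification: a bounded subsolution of the optimality equation bounds the discounted cost of
every policy from below. -/
lemma truncatedCost_le_tsum
    (hnext : Measurable fun q : ProbabilityMeasure M.graph × 𝒵 => M.next q.1 q.2)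
    (hc : Measurable c) (hV : Measurable V) {B : ℝ≥0∞} (hB : B ≠ ⊤) (hVB : ∀ μ, V μ ≤ B)
    (hb : b < 1)
    (hle : ∀ Q, V (M.firstMargin Q) ≤ bellmanCost (M.lawZ0 : Measure 𝒵) M.next c b V Q)
    (ψ : M.Policy) (μ : ProbabilityMeasure S) (n : ℕ) :
    truncatedCost c b V ψ μ n ≤ ∑' k, b ^ k * ∫⁻ ω, c (M.action ψ μ ω k) ∂M.noiseLaw := by
  -- Replacing the terminal cost `V` by one more stage can only raise the total, by the subsolution
  -- inequality.
  have hmono : Monotone (truncatedCost c b V ψ μ) := by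
    refine monotone_nat_of_le_succ fun n => ?_
    rw [truncatedCost_succ hnext hc hV, truncatedCost]
    gcongr with ω
    rw [← firstMargin_action]
    exact hle _
  have hbound : ∀ m, n ≤ m → truncatedCost c b V ψ μ n ≤
      ∑' k, b ^ k * ∫⁻ ω, c (M.action ψ μ ω k) ∂M.noiseLaw + b ^ m * B := by
    intro m hm
    refine (hmono hm).trans ?_
    unfold truncatedCost
    gcongr
    · exact ENNReal.sum_le_tsum _
    · refine (lintegral_mono fun ω => hVB _).trans ?_
      simp
  have hlim : Tendsto (fun m : ℕ => ∑' k, b ^ k * ∫⁻ ω, c (M.action ψ μ ω k) ∂M.noiseLaw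
      + b ^ m * B) atTop (𝓝 (∑' k, b ^ k * ∫⁻ ω, c (M.action ψ μ ω k) ∂M.noiseLaw)) := by
    have h := ENNReal.Tendsto.mul_const (b := B)
      (ENNReal.tendsto_pow_atTop_nhds_zero_of_lt_one hb) (Or.inr hB)
    simpa using h.const_add (∑' k, b ^ k * ∫⁻ ω, c (M.action ψ μ ω k) ∂M.noiseLaw)
  exact ge_of_tendsto hlim ((eventually_ge_atTop n).mono hbound)

/-- Verification: a stationary policy of minimizers has discounted cost at most `V`. -/
lemma tsum_stationary_le
    (hnext : Measurable fun q : ProbabilityMeasure M.graph × 𝒵 => M.next q.1 q.2)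
    (hc : Measurable c) (hV : Measurable V) (φ : M.DecisionRule)
    (hφ : ∀ μ, bellmanCost (M.lawZ0 : Measure 𝒵) M.next c b V (φ.1 μ) ≤ V μ)
    (μ : ProbabilityMeasure S) :
    ∑' k, b ^ k * ∫⁻ ω, c (M.action (stationary φ) μ ω k) ∂M.noiseLaw ≤ V μ := by
  have hanti : Antitone (truncatedCost c b V (stationary φ) μ) := by
    refine antitone_nat_of_succ_le fun n => ?_
    rw [truncatedCost_succ hnext hc hV, truncatedCost]
    gcongr with ω
    exact hφ _
  rw [ENNReal.tsum_eq_iSup_nat]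
  refine iSup_le fun n => ?_
  rw [← truncatedCost_zero (c := c) (b := b) (V := V) (stationary φ) μ]
  exact le_self_add.trans (hanti n.zero_le)

end DynamicProgramming

lemma integrable_reward_action {C : ℝ} (hR : ∀ Q, |M.reward Q| ≤ C) (hRm : Measurable M.reward)
    (hnext : Measurable fun q : ProbabilityMeasure M.graph × 𝒵 => M.next q.1 q.2)
    (ψ : M.Policy) (μ : ProbabilityMeasure S) (k : ℕ) :
    Integrable (fun ω => M.reward (M.action ψ μ ω k)) M.noiseLaw :=
  Integrable.of_bound (hRm.comp (measurable_action hnext ψ μ k)).aestronglyMeasurable C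
    (Eventually.of_forall fun _ => hR _)

lemma abs_expReward_le {C : ℝ} (hR : ∀ Q, |M.reward Q| ≤ C)
    (ψ : M.Policy) (μ : ProbabilityMeasure S) (k : ℕ) : |M.expReward ψ μ k| ≤ C := by
  rw [expReward_eq]
  simpa using norm_integral_le_of_norm_le_const (μ := M.noiseLaw)
    (f := fun ω => M.reward (M.action ψ μ ω k)) (Eventually.of_forall fun ω => hR _)

lemma lintegral_cost_eq {C : ℝ} (hR : ∀ Q, |M.reward Q| ≤ C) (hRm : Measurable M.reward)
    (hnext : Measurable fun q : ProbabilityMeasure M.graph × 𝒵 => M.next q.1 q.2)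
    (ψ : M.Policy) (μ : ProbabilityMeasure S) (k : ℕ) :
    ∫⁻ ω, ENNReal.ofReal (C - M.reward (M.action ψ μ ω k)) ∂M.noiseLaw =
      ENNReal.ofReal (C - M.expReward ψ μ k) := by
  have hi := integrable_reward_action hR hRm hnext ψ μ k
  rw [← ofReal_integral_eq_lintegral_ofReal
    (f := fun ω => C - M.reward (M.action ψ μ ω k)) ((integrable_const C).sub hi)
    (Eventually.of_forall fun ω => sub_nonneg.2 ((le_abs_self _).trans (hR _))),
    integral_sub (integrable_const C) hi, expReward_eq]
  simp

lemma summable_discount {C : ℝ} (hR : ∀ Q, |M.reward Q| ≤ C) {β : ℝ} (hβ : β ∈ Ioo (0 : ℝ) 1)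
    (ψ : M.Policy) (μ : ProbabilityMeasure S) : Summable fun k => β ^ k * M.expReward ψ μ k := by
  refine Summable.of_norm_bounded
    ((summable_geometric_of_lt_one hβ.1.le hβ.2).mul_right C) fun k => ?_
  rw [norm_mul, norm_pow, Real.norm_of_nonneg hβ.1.le]
  exact mul_le_mul_of_nonneg_left (abs_expReward_le hR ψ μ k) (pow_nonneg hβ.1.le k)

lemma abs_discReward_le {C : ℝ} (hR : ∀ Q, |M.reward Q| ≤ C) {β : ℝ} (hβ : β ∈ Ioo (0 : ℝ) 1)
    (ψ : M.Policy) (μ : ProbabilityMeasure S) : |M.discReward β ψ μ| ≤ C / (1 - β) := by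
  have h := tsum_of_norm_bounded ((hasSum_geometric_of_lt_one hβ.1.le hβ.2).mul_right C)
    (f := fun k => β ^ k * M.expReward ψ μ k) fun k => by
    rw [norm_mul, norm_pow, Real.norm_of_nonneg hβ.1.le]
    exact mul_le_mul_of_nonneg_left (abs_expReward_le hR ψ μ k) (pow_nonneg hβ.1.le k)
  rw [div_eq_inv_mul]
  exact h

/-- Charging `C` per stage adds the geometric total `C / (1 - β)`, so minimizing this cost is
maximizing the discounted reward. -/
lemma tsum_cost_eq {C : ℝ} (hR : ∀ Q, |M.reward Q| ≤ C) (hRm : Measurable M.reward)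
    (hnext : Measurable fun q : ProbabilityMeasure M.graph × 𝒵 => M.next q.1 q.2)
    {β : ℝ} (hβ : β ∈ Ioo (0 : ℝ) 1) (ψ : M.Policy) (μ : ProbabilityMeasure S) :
    ∑' k, ENNReal.ofReal β ^ k *
        ∫⁻ ω, ENNReal.ofReal (C - M.reward (M.action ψ μ ω k)) ∂M.noiseLaw =
      ENNReal.ofReal (C / (1 - β) - M.discReward β ψ μ) := by
  have hg := (hasSum_geometric_of_lt_one hβ.1.le hβ.2).mul_right C
  have hs := hg.sub (summable_discount hR hβ ψ μ).hasSum
  rw [div_eq_inv_mul, discReward, ← hs.tsum_eq, ENNReal.ofReal_tsum_of_nonneg _ hs.summable]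
  · refine tsum_congr fun k => ?_
    rw [lintegral_cost_eq hR hRm hnext, ← ENNReal.ofReal_pow hβ.1.le,
      ← ENNReal.ofReal_mul (pow_nonneg hβ.1.le k), mul_sub]
  · intro k
    rw [← mul_sub]
    exact mul_nonneg (pow_nonneg hβ.1.le k)
      (sub_nonneg.2 ((le_abs_self _).trans (abs_expReward_le hR ψ μ k)))

end MeanFieldModel

lemma upperSemicontinuous_neg_coe {X : Type*} [TopologicalSpace X] {f : X → ℝ≥0∞}
    (hf : LowerSemicontinuous f) : UpperSemicontinuous fun x => -(f x : EReal) :=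
  (continuous_neg.comp continuous_coe_ennreal_ereal).comp_lowerSemicontinuous_antitone hf
    fun _ _ h => EReal.neg_le_neg_iff.2 (EReal.coe_ennreal_le_coe_ennreal_iff.2 h)

/-! ### The discounted control problem. -/

namespace MeanFieldModel

lemma bddAbove_discReward {S A 𝒵 : Type*} [MeasurableSpace S] [MeasurableSpace A]
    [MeasurableSpace 𝒵] {M : MeanFieldModel S A 𝒵} {β : ℝ} (hβ : β ∈ Ioo (0 : ℝ) 1) (μ : ProbabilityMeasure S) :
    BddAbove (range fun ψ : M.Policy => M.discReward β ψ μ) := by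
  obtain ⟨C, -, hC⟩ := M.exists_bound_reward
  refine ⟨C / (1 - β), ?_⟩
  rintro _ ⟨ψ, rfl⟩
  exact (le_abs_self _).trans (abs_discReward_le hC hβ ψ μ)

section Topological

variable {S A 𝒵 : Type*} [MeasurableSpace S] [MeasurableSpace A] [MeasurableSpace 𝒵]
    [TopologicalSpace S] [CompactSpace S] [TopologicalSpace.MetrizableSpace S]
    [SecondCountableTopology S] [BorelSpace S]
    [TopologicalSpace A] [TopologicalSpace.MetrizableSpace A]
    [SecondCountableTopology A] [BorelSpace A]
    {M : MeanFieldModel S A 𝒵}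

/-- A maximizer of an upper semicontinuous function of the action over the admissible actions in
a closed set can be chosen measurably in the state. -/
lemma exists_decisionRule_argmax [CompactSpace M.graph] {s : Set (ProbabilityMeasure M.graph)}
    (hs : IsClosed s) (hps : ∀ μ, ∃ Q ∈ s, M.firstMargin Q = μ)
    {g : ProbabilityMeasure M.graph → EReal} (hg : UpperSemicontinuous g) :
    ∃ φ : M.DecisionRule, ∀ μ, φ.1 μ ∈ s ∧ ∀ Q ∈ s, M.firstMargin Q = μ → g Q ≤ g (φ.1 μ) := by
  obtain ⟨φ, hφ, h⟩ := exists_measurable_argmax_fiber M.continuous_firstMargin hs hps hg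
  exact ⟨⟨φ, hφ, fun μ => (h μ).2.1⟩, fun μ => ⟨(h μ).1, (h μ).2.2⟩⟩

variable [TopologicalSpace 𝒵] [TopologicalSpace.MetrizableSpace 𝒵]
    [SecondCountableTopology 𝒵] [BorelSpace 𝒵]

lemma measurable_next [CompactSpace M.graph] (hT : M.ContinuousTransition) :
    Measurable fun q : ProbabilityMeasure M.graph × 𝒵 => M.next q.1 q.2 := by
  have := secondCountableTopology_of_compact_metrizable (X := ProbabilityMeasure M.graph)
  exact (M.continuous_next hT).measurable

/-- The discounted problem: the value function is measurable, there is an optimal decision rule,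
and every optimal decision rule satisfies the optimality equation. -/
theorem discount_optimality [CompactSpace M.graph] (hr : M.ContinuousReward)
    (hT : M.ContinuousTransition) {β : ℝ} (hβ : β ∈ Ioo (0 : ℝ) 1) :
    Measurable (M.discValue β) ∧ (∃ φ : M.DecisionRule, M.IsDiscountOptimal β φ) ∧
      ∀ φ : M.DecisionRule, M.IsDiscountOptimal β φ → ∀ μ, M.discValue β μ =
        M.reward (φ.1 μ) + β * ∫ z, M.discValue β (M.next (φ.1 μ) z) ∂(M.lawZ0 : Measure 𝒵) := by
  obtain ⟨C, hC0, hC⟩ := M.exists_bound_reward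
  have hβ1 : 0 < 1 - β := sub_pos.2 hβ.2
  have hnext := measurable_next hT
  have hRm := (M.continuous_reward hr).measurable
  let c : ProbabilityMeasure M.graph → ℝ≥0∞ := fun Q => ENNReal.ofReal (C - M.reward Q)
  have hcc : Continuous c :=
    ENNReal.continuous_ofReal.comp (continuous_const.sub (M.continuous_reward hr))
  have hcb : ∀ Q, c Q ≤ ENNReal.ofReal (2 * C) := fun Q =>
    ENNReal.ofReal_le_ofReal (by linarith [neg_le_of_abs_le (hC Q)])
  -- Stage costs are at most `2C`, and `2C / (1 - β)` is the fixed point of `x ↦ 2C + βx`.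
  have hB : ENNReal.ofReal (2 * C) + ENNReal.ofReal β * ENNReal.ofReal (2 * C / (1 - β)) ≤
      ENNReal.ofReal (2 * C / (1 - β)) := by
    rw [← ENNReal.ofReal_mul hβ.1.le, ← ENNReal.ofReal_add (by positivity)
      (mul_nonneg hβ.1.le (by positivity))]
    refine ENNReal.ofReal_le_ofReal (le_of_eq ?_)
    field_simp
    ring
  obtain ⟨V, hVlsc, hVB, hVle, hVatt⟩ := exists_lowerSemicontinuous_bellman
    (P := (M.lawZ0 : Measure 𝒵)) (τ := M.next) (c := c) (β := ENNReal.ofReal β)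
    M.continuous_firstMargin M.exists_firstMargin_eq
    (M.continuous_next hT) hcc.lowerSemicontinuous hcb ENNReal.ofReal_ne_top hB
  have hWlsc := lowerSemicontinuous_bellmanCost (P := (M.lawZ0 : Measure 𝒵)) hVlsc
    (M.continuous_next hT) hcc.lowerSemicontinuous (ENNReal.ofReal_ne_top (r := β))
  have hVtop : ∀ μ, V μ ≠ ⊤ := fun μ => ((hVB μ).trans_lt ENNReal.ofReal_lt_top).ne
  have hb1 : ENNReal.ofReal β < 1 := by simpa using hβ.2
  have hlow : ∀ ψ μ n, truncatedCost c (ENNReal.ofReal β) V ψ μ n ≤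
      ENNReal.ofReal (C / (1 - β) - M.discReward β ψ μ) := fun ψ μ n => by
    rw [← tsum_cost_eq hC hRm hnext hβ]
    exact truncatedCost_le_tsum hnext hcc.measurable hVlsc.measurable ENNReal.ofReal_ne_top hVB
      hb1 hVle ψ μ n
  have hnonneg : ∀ ψ μ, 0 ≤ C / (1 - β) - M.discReward β ψ μ := fun ψ μ =>
    sub_nonneg.2 ((le_abs_self _).trans (abs_discReward_le hC hβ ψ μ))
  have hdisc : ∀ ψ μ, M.discReward β ψ μ ≤ C / (1 - β) - (V μ).toReal := fun ψ μ => by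
    have h := hlow ψ μ 0
    rw [truncatedCost_zero] at h
    have := ENNReal.toReal_le_of_le_ofReal (hnonneg ψ μ) h
    linarith
  obtain ⟨φ₀, hφ₀⟩ := exists_decisionRule_argmax (M := M) isClosed_univ
    (fun μ => (M.exists_firstMargin_eq μ).imp fun Q hQ => ⟨mem_univ Q, hQ⟩)
    (g := fun Q => -((bellmanCost (M.lawZ0 : Measure 𝒵) M.next c (ENNReal.ofReal β) V Q
      : ℝ≥0∞) : EReal)) (upperSemicontinuous_neg_coe hWlsc)
  have hφ₀V : ∀ μ, bellmanCost (M.lawZ0 : Measure 𝒵) M.next c (ENNReal.ofReal β) V (φ₀.1 μ)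
      ≤ V μ := fun μ => by
    obtain ⟨Q, hQ, h⟩ := hVatt μ
    have := (hφ₀ μ).2 Q (mem_univ Q) hQ
    rw [EReal.neg_le_neg_iff, EReal.coe_ennreal_le_coe_ennreal_iff] at this
    exact this.trans h
  have hφ₀disc : ∀ μ, C / (1 - β) - (V μ).toReal ≤ M.discReward β (stationary φ₀) μ := fun μ => by
    have h := tsum_stationary_le hnext hcc.measurable hVlsc.measurable φ₀ hφ₀V μ
    rw [tsum_cost_eq hC hRm hnext hβ] at h
    have := (ENNReal.ofReal_le_iff_le_toReal (hVtop μ)).1 h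
    linarith
  have hval : ∀ μ, M.discValue β μ = C / (1 - β) - (V μ).toReal := fun μ => by
    have : Nonempty M.Policy := ⟨stationary φ₀⟩
    exact le_antisymm (ciSup_le fun ψ => hdisc ψ μ)
      ((hφ₀disc μ).trans (le_ciSup (bddAbove_discReward hβ μ) (stationary φ₀)))
  refine ⟨?_, ⟨φ₀, fun μ => ?_⟩, fun φ hφ μ => ?_⟩
  · rw [funext hval]
    exact measurable_const.sub hVlsc.measurable.ennreal_toReal
  · rw [hval]
    exact le_antisymm (hdisc _ μ) (hφ₀disc μ)
  -- One stage of `φ` followed by `V` costs at most the whole discounted cost of `φ`, which equals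
  -- `V μ` by optimality; the converse bound is the optimality equation.
  · have hW : bellmanCost (M.lawZ0 : Measure 𝒵) M.next c (ENNReal.ofReal β) V (φ.1 μ) = V μ := by
      refine le_antisymm ?_ ?_
      · have h := hlow (stationary φ) μ 1
        rw [truncatedCost_one hnext hcc.measurable hVlsc.measurable, hφ μ, hval, sub_sub_cancel,
          ENNReal.ofReal_toReal (hVtop μ)] at h
        exact h
      · have h := hVle (φ.1 μ)
        rwa [firstMargin_decisionRule] at h
    have hVn : Measurable fun z => V (M.next (φ.1 μ) z) :=
      hVlsc.measurable.comp (hnext.comp measurable_prodMk_left)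
    have hI : ∫⁻ z, V (M.next (φ.1 μ) z) ∂(M.lawZ0 : Measure 𝒵) ≠ ⊤ := by
      refine ((lintegral_mono fun z => hVB _).trans_lt ?_).ne
      simp
    have hint : ∫ z, M.discValue β (M.next (φ.1 μ) z) ∂(M.lawZ0 : Measure 𝒵) =
        C / (1 - β) - (∫⁻ z, V (M.next (φ.1 μ) z) ∂(M.lawZ0 : Measure 𝒵)).toReal := by
      simp only [hval]
      rw [integral_sub (integrable_const _)
        (integrable_toReal_of_lintegral_ne_top hVn.aemeasurable hI),
        integral_toReal hVn.aemeasurable (Eventually.of_forall fun z => (hVtop _).lt_top)]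
      simp
    have hWr := congrArg ENNReal.toReal hW
    unfold bellmanCost at hWr
    rw [ENNReal.toReal_add ENNReal.ofReal_ne_top (ENNReal.mul_ne_top ENNReal.ofReal_ne_top hI),
      ENNReal.toReal_mul, ENNReal.toReal_ofReal hβ.1.le,
      ENNReal.toReal_ofReal (sub_nonneg.2 ((le_abs_self _).trans (hC _)))] at hWr
    rw [hint, hval, ← hWr]
    field_simp
    ring

end Topological

end MeanFieldModel

/-! ### Cesàro averages, Abel sums and limsup sequences. -/

section RealSequences

/-- Abelian inequality: a lower bound for partial sums is a lower bound for Abel sums. -/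
lemma neg_le_tsum_pow_mul_of_partial_sums {d : ℕ → ℝ} {B β : ℝ} (hβ : β ∈ Ioo (0 : ℝ) 1)
    (hd : ∀ n, -B ≤ ∑ k ∈ Finset.range n, d k) (hs : Summable fun k => β ^ k * d k) :
    -B ≤ ∑' k, β ^ k * d k := by
  -- Summation by parts as an induction: the shifted partial sums are nonnegative, so lowering their
  -- weight from `β ^ n` to `β ^ (n + 1)` only decreases the left side.
  have h : ∀ n, β ^ n * (∑ k ∈ Finset.range n, d k + B) - B ≤
      ∑ k ∈ Finset.range n, β ^ k * d k := by
    intro n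
    induction n with
    | zero => simp
    | succ n ih =>
      have h1 : β ^ (n + 1) * (∑ k ∈ Finset.range (n + 1), d k + B) ≤
          β ^ n * (∑ k ∈ Finset.range (n + 1), d k + B) :=
        mul_le_mul_of_nonneg_right (pow_le_pow_of_le_one hβ.1.le hβ.2.le n.le_succ)
          (by linarith [hd (n + 1)])
      rw [Finset.sum_range_succ] at h1 ⊢
      rw [Finset.sum_range_succ (fun k => β ^ k * d k)]
      linarith
  refine ge_of_tendsto hs.hasSum.tendsto_sum_nat (Eventually.of_forall fun n => ?_)
  have := mul_nonneg (pow_nonneg hβ.1.le n) (by linarith [hd n] :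
    0 ≤ ∑ k ∈ Finset.range n, d k + B)
  linarith [h n]

lemma abs_average_le {u : ℕ → ℝ} {C : ℝ} (hu : ∀ k, |u k| ≤ C) (n : ℕ) :
    |1 / (n : ℝ) * ∑ k ∈ Finset.range n, u k| ≤ C := by
  have hC : 0 ≤ C := (abs_nonneg _).trans (hu 0)
  rcases Nat.eq_zero_or_pos n with rfl | hn
  · simpa using hC
  have hn' : (0 : ℝ) < n := Nat.cast_pos.2 hn
  rw [abs_mul, abs_of_nonneg (by positivity : (0 : ℝ) ≤ 1 / n), one_div, inv_mul_le_iff₀ hn']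
  refine (Finset.abs_sum_le_sum_abs _ _).trans ((Finset.sum_le_sum fun k _ => hu k).trans ?_)
  simp

lemma exists_partial_sum_bound_of_lt_liminf {u : ℕ → ℝ} {C γ : ℝ} (hu : ∀ k, |u k| ≤ C)
    (hγ : γ < liminf (fun n : ℕ => 1 / (n : ℝ) * ∑ k ∈ Finset.range n, u k) atTop) :
    ∃ B, ∀ n, -B ≤ ∑ k ∈ Finset.range n, (u k - γ) := by
  have hb : IsBoundedUnder (· ≥ ·) atTop
      fun n : ℕ => 1 / (n : ℝ) * ∑ k ∈ Finset.range n, u k :=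
    isBoundedUnder_of ⟨-C, fun n => neg_le_of_abs_le (abs_average_le hu n)⟩
  obtain ⟨N, hN⟩ := eventually_atTop.1 (eventually_lt_of_lt_liminf hγ hb)
  have hC : 0 ≤ C := (abs_nonneg _).trans (hu 0)
  -- From `N` on the partial sums are nonnegative; this constant absorbs those of fewer than `N`
  -- terms.
  refine ⟨N * (C + |γ|), fun n => ?_⟩
  have hpos : 0 ≤ N * (C + |γ|) := by positivity
  rcases le_or_gt N n with h | h
  · rcases Nat.eq_zero_or_pos n with rfl | hn
    · simpa using hpos
    have hn' : (0 : ℝ) < n := Nat.cast_pos.2 hn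
    have h1 := hN n h
    rw [one_div, lt_inv_mul_iff₀ hn'] at h1
    rw [Finset.sum_sub_distrib, Finset.sum_const, Finset.card_range, nsmul_eq_mul]
    linarith
  · have h1 : |∑ k ∈ Finset.range n, (u k - γ)| ≤ n * (C + |γ|) := by
      refine (Finset.abs_sum_le_sum_abs _ _).trans
        ((Finset.sum_le_sum fun k _ => (abs_sub _ _).trans (add_le_add_left (hu k) _)).trans ?_)
      simp [mul_add]
    have h2 : (n : ℝ) * (C + |γ|) ≤ N * (C + |γ|) := by
      have : (n : ℝ) ≤ N := by exact_mod_cast h.le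
      gcongr
    linarith [neg_le_of_abs_le h1]

lemma le_liminf_average {u : ℕ → ℝ} {C ρ B : ℝ} (hu : ∀ k, |u k| ≤ C)
    (h : ∀ n : ℕ, n * ρ - B ≤ ∑ k ∈ Finset.range n, u k) :
    ρ ≤ liminf (fun n : ℕ => 1 / (n : ℝ) * ∑ k ∈ Finset.range n, u k) atTop := by
  have ht : Tendsto (fun n : ℕ => ρ - B / (n : ℝ)) atTop (𝓝 ρ) := by
    simpa using (tendsto_const_div_atTop_nhds_zero_nat B).const_sub ρ
  rw [← ht.liminf_eq]
  refine liminf_le_liminf ?_ ht.isBoundedUnder_ge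
    (isBoundedUnder_of ⟨C, fun n => (le_abs_self _).trans (abs_average_le hu n)⟩
      |>.isCoboundedUnder_ge)
  filter_upwards [eventually_gt_atTop 0] with n hn
  have hn' : (0 : ℝ) < n := Nat.cast_pos.2 hn
  rw [one_div, le_inv_mul_iff₀ hn', mul_sub, mul_div_cancel₀ _ hn'.ne']
  exact h n

lemma exists_strictMono_tendsto_limsup_nhdsLT {f : ℝ → ℝ} {a b C : ℝ} (hab : a < b)
    (hf : ∀ᶠ x in 𝓝[<] b, |f x| ≤ C) :
    ∃ u : ℕ → ℝ, StrictMono u ∧ (∀ n, u n ∈ Ioo a b) ∧ Tendsto u atTop (𝓝 b) ∧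
      Tendsto (fun n => f (u n)) atTop (𝓝 (limsup f (𝓝[<] b))) := by
  have hle : IsBoundedUnder (· ≤ ·) (𝓝[<] b) f :=
    isBoundedUnder_of_eventually_le (hf.mono fun x hx => (le_abs_self _).trans hx)
  have hge : IsBoundedUnder (· ≥ ·) (𝓝[<] b) f :=
    isBoundedUnder_of_eventually_ge (hf.mono fun x hx => neg_le_of_abs_le hx)
  set s := limsup f (𝓝[<] b) with hs
  -- The premise `x < b` stands inside the existential so that `choose` returns a total function,
  -- which is then iterated from `a`.
  have key : ∀ (n : ℕ) (x : ℝ), ∃ y, x < b → x < y ∧ y ∈ Ioo a b ∧ b - 1 / ((n : ℝ) + 1) < y ∧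
      |f y - s| < 1 / ((n : ℝ) + 1) := by
    intro n x
    by_cases hx : x < b
    swap
    · exact ⟨x, fun h => absurd h hx⟩
    have hε : (0 : ℝ) < 1 / ((n : ℝ) + 1) := by positivity
    have h1 : ∃ᶠ y in 𝓝[<] b, s - 1 / ((n : ℝ) + 1) < f y :=
      frequently_lt_of_lt_limsup hge.isCoboundedUnder_le (by linarith)
    have h2 : ∀ᶠ y in 𝓝[<] b, f y < s + 1 / ((n : ℝ) + 1) :=
      eventually_lt_of_limsup_lt (by linarith) hle
    have h3 : ∀ᶠ y in 𝓝[<] b, y ∈ Ioo (max x (max a (b - 1 / ((n : ℝ) + 1)))) b :=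
      Ioo_mem_nhdsLT (max_lt hx (max_lt hab (by linarith)))
    obtain ⟨y, hy1, hy2, hy3⟩ := (h1.and_eventually (h2.and h3)).exists
    have hm := max_lt_iff.1 hy3.1
    have hm' := max_lt_iff.1 hm.2
    exact ⟨y, fun _ => ⟨hm.1, ⟨hm'.1, hy3.2⟩, hm'.2, abs_sub_lt_iff.2 ⟨by linarith, by linarith⟩⟩⟩
  choose g hg using key
  let u : ℕ → ℝ := fun n => Nat.rec (g 0 a) (fun n x => g (n + 1) x) n
  have hu : ∀ n, u n < b := by
    intro n
    induction n with
    | zero => exact (hg 0 a hab).2.1.2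
    | succ n ih => exact (hg (n + 1) (u n) ih).2.1.2
  have hspec : ∀ n, u n ∈ Ioo a b ∧ b - 1 / ((n : ℝ) + 1) < u n ∧
      |f (u n) - s| < 1 / ((n : ℝ) + 1) := by
    intro n
    cases n with
    | zero => exact (hg 0 a hab).2
    | succ n => exact (hg (n + 1) (u n) (hu n)).2
  refine ⟨u, strictMono_nat_of_lt_succ fun n => (hg (n + 1) (u n) (hu n)).1,
    fun n => (hspec n).1, ?_, ?_⟩
  · refine tendsto_of_tendsto_of_tendsto_of_le_of_le ?_ tendsto_const_nhds
      (fun n => (hspec n).2.1.le) (fun n => (hu n).le)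
    simpa using (tendsto_one_div_add_atTop_nhds_zero_nat (𝕜 := ℝ)).const_sub b
  · rw [tendsto_iff_norm_sub_tendsto_zero]
    exact squeeze_zero (fun n => norm_nonneg _) (fun n => (hspec n).2.2.le)
      tendsto_one_div_add_atTop_nhds_zero_nat

end RealSequences

/-! ### Upper and lower bounds for the average reward. -/

namespace MeanFieldModel

variable {S A 𝒵 : Type*} [MeasurableSpace S] [MeasurableSpace A] [MeasurableSpace 𝒵]
  {M : MeanFieldModel S A 𝒵}

lemma abs_discValue_le [Nonempty M.Policy] {C : ℝ} (hR : ∀ Q, |M.reward Q| ≤ C) {β : ℝ}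
    (hβ : β ∈ Ioo (0 : ℝ) 1) (μ : ProbabilityMeasure S) :
    |(1 - β) * M.discValue β μ| ≤ C := by
  have hβ1 : 0 < 1 - β := sub_pos.2 hβ.2
  have h : |M.discValue β μ| ≤ C / (1 - β) := by
    have hb := fun ψ : M.Policy => abs_le.1 (abs_discReward_le hR hβ ψ μ)
    refine abs_le.2 ⟨?_, ciSup_le fun ψ => (hb ψ).2⟩
    obtain ⟨ψ⟩ := ‹Nonempty M.Policy›
    exact (hb ψ).1.trans (le_ciSup (f := fun ψ : M.Policy => M.discReward β ψ μ)
      ⟨C / (1 - β), by rintro _ ⟨ψ, rfl⟩; exact (hb ψ).2⟩ ψ)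
  rw [abs_mul, abs_of_pos hβ1]
  rwa [le_div_iff₀' hβ1] at h

/-- The average reward is at most the limit of the normalized discounted values. -/
lemma avgReward_le {C : ℝ} (hR : ∀ Q, |M.reward Q| ≤ C) {β : ℕ → ℝ} {L ρ : ℝ}
    {μ ν : ProbabilityMeasure S} (hβ : ∀ k, β k ∈ Ioo (0 : ℝ) 1) (hβ1 : Tendsto β atTop (𝓝 1))
    (hL : ∀ k, M.discValue (β k) μ - M.discValue (β k) ν ≤ L)
    (hρ : Tendsto (fun k => (1 - β k) * M.discValue (β k) ν) atTop (𝓝 ρ)) (ψ : M.Policy) :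
    M.avgReward ψ μ ≤ ρ := by
  refine le_of_forall_lt fun γ hγ => ?_
  obtain ⟨γ', hγγ', hγ'⟩ := exists_between hγ
  refine hγγ'.trans_le ?_
  obtain ⟨B, hB⟩ := exists_partial_sum_bound_of_lt_liminf (abs_expReward_le hR ψ μ) hγ'
  -- The Abelian inequality bounds the discounted reward below by `γ' / (1 - β k) - B`; passing from
  -- `μ` to `ν` costs at most `L`, and both constants vanish after multiplication by `1 - β k`.
  have key : ∀ k, γ' - (1 - β k) * (B + L) ≤ (1 - β k) * M.discValue (β k) ν := fun k => by
    have h1k : 0 < 1 - β k := sub_pos.2 (hβ k).2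
    have hs := summable_discount hR (hβ k) ψ μ
    have hg := (hasSum_geometric_of_lt_one (hβ k).1.le (hβ k).2).mul_right γ'
    have hd := hs.hasSum.sub hg
    simp only [← mul_sub] at hd
    have h := neg_le_tsum_pow_mul_of_partial_sums (hβ k) hB hd.summable
    rw [hd.tsum_eq] at h
    have hle : M.discReward (β k) ψ μ ≤ M.discValue (β k) μ :=
      le_ciSup (f := fun ψ : M.Policy => M.discReward (β k) ψ μ)
        ⟨C / (1 - β k), by
          rintro _ ⟨ψ, rfl⟩; exact (le_abs_self _).trans (abs_discReward_le hR (hβ k) ψ μ)⟩ ψ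
    have h2 : (1 - β k)⁻¹ * γ' - B - L ≤ M.discValue (β k) ν := by
      have := hL k
      unfold discReward at hle
      linarith
    calc γ' - (1 - β k) * (B + L) = (1 - β k) * ((1 - β k)⁻¹ * γ' - B - L) := by
          field_simp
          ring
      _ ≤ _ := mul_le_mul_of_nonneg_left h2 h1k.le
  have hlim : Tendsto (fun k => γ' - (1 - β k) * (B + L)) atTop (𝓝 γ') := by
    simpa using ((hβ1.const_sub 1).mul_const (B + L)).const_sub γ'
  exact le_of_tendsto_of_tendsto' hlim hρ key

/-- Verification for the average reward: if `g` is finite and the optimality inequality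
`E c + E g ∘ next + (C + ρ) ≤ g + 2C` holds along `φ`, with `c = C - r̃` the one-stage cost, then
the stationary policy has average reward at least `ρ`. -/
lemma le_avgReward_stationary {C ρ : ℝ} (hR : ∀ Q, |M.reward Q| ≤ C) (hRm : Measurable M.reward)
    (hnext : Measurable fun q : ProbabilityMeasure M.graph × 𝒵 => M.next q.1 q.2)
    (hCρ : 0 ≤ C + ρ) {g : ProbabilityMeasure S → ℝ≥0∞} (hg : Measurable g)
    (hgtop : ∀ μ, g μ ≠ ⊤) (φ : M.DecisionRule)
    (hφ : ∀ μ, bellmanCost (M.lawZ0 : Measure 𝒵) M.next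
      (fun Q => ENNReal.ofReal (C - M.reward Q)) 1 g (φ.1 μ) + ENNReal.ofReal (C + ρ) ≤
        g μ + ENNReal.ofReal (2 * C)) (μ : ProbabilityMeasure S) :
    ρ ≤ M.avgReward (stationary φ) μ := by
  have hC : 0 ≤ C := (abs_nonneg _).trans (hR (φ.1 μ))
  have hc : Measurable fun Q : ProbabilityMeasure M.graph => ENNReal.ofReal (C - M.reward Q) :=
    (measurable_const.sub hRm).ennreal_ofReal
  -- Telescoping in purely additive form: terms of `ℝ≥0∞` are never cancelled, since `G` may be
  -- infinite here.
  have hadd : ∀ {a w n r G r' g n' : ℝ≥0∞}, a + G + n ≤ g + n' → w + r ≤ G + r' →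
      a + w + (n + r) ≤ g + (n' + r') := fun {a w n r G r' g n'} h1 h2 =>
    calc a + w + (n + r) = a + n + (w + r) := by ring
      _ ≤ a + n + (G + r') := by gcongr
      _ = a + G + n + r' := by ring
      _ ≤ g + n' + r' := by gcongr
      _ = g + (n' + r') := add_assoc _ _ _
  have key : ∀ n : ℕ, truncatedCost (fun Q => ENNReal.ofReal (C - M.reward Q)) 1 g
      (stationary φ) μ n + n * ENNReal.ofReal (C + ρ) ≤ g μ + n * ENNReal.ofReal (2 * C) := by
    intro n
    induction n with
    | zero => simp [truncatedCost_zero]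
    | succ n ih =>
      have hstep : ∫⁻ ω, bellmanCost (M.lawZ0 : Measure 𝒵) M.next
          (fun Q => ENNReal.ofReal (C - M.reward Q)) 1 g (M.action (stationary φ) μ ω n)
            ∂M.noiseLaw + ENNReal.ofReal (C + ρ) ≤
          ∫⁻ ω, g (M.state (stationary φ) μ ω n) ∂M.noiseLaw + ENNReal.ofReal (2 * C) := by
        have := lintegral_mono (μ := M.noiseLaw) fun ω => hφ (M.state (stationary φ) μ ω n)
        rw [lintegral_add_right _ measurable_const, lintegral_add_right _ measurable_const] at this
        simp only [lintegral_const, measure_univ, mul_one] at this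
        exact this
      rw [truncatedCost_succ hnext hc hg]
      unfold truncatedCost at ih
      simp only [one_pow, one_mul, Nat.cast_succ, add_mul] at ih ⊢
      exact hadd ih hstep
  refine le_liminf_average (B := (g μ).toReal) (abs_expReward_le hR _ μ) fun n => ?_
  have h := (add_le_add_left (le_self_add) _).trans (key n)
  simp only [one_pow, one_mul, lintegral_cost_eq hR hRm hnext] at h
  have hnn : ∀ k, 0 ≤ C - M.expReward (stationary φ) μ k := fun k =>
    sub_nonneg.2 ((le_abs_self _).trans (abs_expReward_le hR _ μ k))
  rw [← ENNReal.ofReal_sum_of_nonneg fun k _ => hnn k, ← ENNReal.ofReal_natCast,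
    ← ENNReal.ofReal_mul n.cast_nonneg, ← ENNReal.ofReal_mul n.cast_nonneg,
    ← ENNReal.ofReal_add (Finset.sum_nonneg fun k _ => hnn k) (by positivity),
    ← ENNReal.ofReal_toReal (hgtop μ), ← ENNReal.ofReal_add ENNReal.toReal_nonneg (by positivity),
    ENNReal.ofReal_le_ofReal_iff (by positivity), Finset.sum_sub_distrib, Finset.sum_const,
    Finset.card_range, nsmul_eq_mul] at h
  linarith

end MeanFieldModel

/-! ### Relaxed lower limits and Fatou's lemma. -/

section RelaxedLiminf

variable {E : Type*} [TopologicalSpace E]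

/-- The lower relaxed limit of a sequence of functions: the limit inferior of `u k x'` as
`k → ∞` and `x' → x`. -/
def relaxedLiminf (u : ℕ → E → ℝ≥0∞) (x : E) : ℝ≥0∞ :=
  liminf (fun q : ℕ × E => u q.1 q.2) (atTop ×ˢ 𝓝 x)

variable {u : ℕ → E → ℝ≥0∞}

/-- A neighbourhood of `x` on which the tail of `u` exceeds `a'` is also a neighbourhood of all
points near `x`. The intermediate `a'` keeps the inequality strict. -/
lemma lowerSemicontinuous_relaxedLiminf : LowerSemicontinuous (relaxedLiminf u) := by
  intro x a ha
  obtain ⟨a', ha, ha'⟩ := exists_between (show a < relaxedLiminf u x from ha)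
  have h : ∀ᶠ q : ℕ × E in atTop ×ˢ 𝓝 x, a' < u q.1 q.2 := eventually_lt_of_lt_liminf ha'
  obtain ⟨s, hs, t, ht, hst⟩ := mem_prod_iff.1 h
  filter_upwards [eventually_mem_nhds_iff.2 ht] with y hy
  refine lt_of_lt_of_le ha (le_liminf_of_le (by isBoundedDefault) ?_)
  filter_upwards [prod_mem_prod hs hy] with q hq
  exact (hst hq).le

lemma relaxedLiminf_le {x : E} {B : ℝ≥0∞} (h : ∀ k, u k x ≤ B) : relaxedLiminf u x ≤ B := by
  refine liminf_le_of_frequently_le' ?_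
  have ht : Tendsto (fun k : ℕ => (k, x)) atTop (atTop ×ˢ 𝓝 x) :=
    tendsto_id.prodMk tendsto_const_nhds
  exact ht.frequently (Eventually.frequently (Eventually.of_forall h))

lemma relaxedLiminf_le_liminf {x : E} {k : ℕ → ℕ} {y : ℕ → E} (hk : Tendsto k atTop atTop)
    (hy : Tendsto y atTop (𝓝 x)) :
    relaxedLiminf u x ≤ liminf (fun j => u (k j) (y j)) atTop :=
  (hk.prodMk hy).liminf_le_liminf_comp

/-- A recovery sequence: indices and points along which `u` stays below its relaxed limit up to a
vanishing error. -/
lemma exists_seq_lt_relaxedLiminf_add [FirstCountableTopology E] {x : E}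
    (hx : relaxedLiminf u x ≠ ⊤) :
    ∃ (k : ℕ → ℕ) (y : ℕ → E), Tendsto k atTop atTop ∧ Tendsto y atTop (𝓝 x) ∧
      ∀ j : ℕ, u (k j) (y j) ≤ relaxedLiminf u x + ((j : ℝ≥0∞) + 1)⁻¹ := by
  obtain ⟨V, hV⟩ := (atTop ×ˢ 𝓝 x : Filter (ℕ × E)).exists_antitone_basis
  have h : ∀ j : ℕ, ∃ q ∈ V j, u q.1 q.2 < relaxedLiminf u x + ((j : ℝ≥0∞) + 1)⁻¹ := fun j => by
    have hf : ∃ᶠ q : ℕ × E in atTop ×ˢ 𝓝 x,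
        u q.1 q.2 < relaxedLiminf u x + ((j : ℝ≥0∞) + 1)⁻¹ :=
      frequently_lt_of_liminf_lt (by isBoundedDefault) (ENNReal.lt_add_right hx (by simp))
    obtain ⟨q, hq, hqV⟩ := (hf.and_eventually (hV.mem j)).exists
    exact ⟨q, hqV, hq⟩
  choose q hqV hq using h
  have ht := hV.tendsto hqV
  exact ⟨fun j => (q j).1, fun j => (q j).2, tendsto_fst.comp ht, tendsto_snd.comp ht,
    fun j => (hq j).le⟩

/-- Fatou's lemma along relaxed limits, in the form in which it is applied to optimality
equations. -/
lemma lintegral_relaxedLiminf_add_le [MeasurableSpace E] [OpensMeasurableSpace E]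
    {K Z : Type*} [TopologicalSpace K] [TopologicalSpace Z] [MeasurableSpace Z]
    [OpensMeasurableSpace Z] [BorelSpace E] {P : Measure Z} {τ : K → Z → E}
    (hτ : Continuous fun q : K × Z => τ q.1 q.2) (hu : ∀ k, Measurable (u k))
    {k : ℕ → ℕ} {Q : ℕ → K} {Q₀ : K} (hk : Tendsto k atTop atTop) (hQ : Tendsto Q atTop (𝓝 Q₀))
    {b a r : ℕ → ℝ≥0∞} {a₀ r₀ : ℝ≥0∞} (hb : Tendsto b atTop (𝓝 1)) (ha : Tendsto a atTop (𝓝 a₀))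
    (hr : Tendsto r atTop (𝓝 r₀)) (hatop : ∀ j, a j ≠ ⊤) (ha₀ : a₀ ≠ ⊤)
    (h : ∀ j, a j + b j * ∫⁻ z, u (k j) (τ (Q j) z) ∂P ≤ r j) :
    a₀ + ∫⁻ z, relaxedLiminf u (τ Q₀ z) ∂P ≤ r₀ := by
  have hz : ∀ k, Continuous (τ k) := fun k => hτ.comp (by fun_prop : Continuous fun z : Z => (k, z))
  have h1 : ∫⁻ z, relaxedLiminf u (τ Q₀ z) ∂P ≤
      liminf (fun j => ∫⁻ z, u (k j) (τ (Q j) z) ∂P) atTop := by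
    refine (lintegral_mono fun z => ?_).trans
      (lintegral_liminf_le fun j => (hu (k j)).comp (hz (Q j)).measurable)
    exact relaxedLiminf_le_liminf hk ((hτ.tendsto (Q₀, z)).comp (hQ.prodMk_nhds tendsto_const_nhds))
  -- The factors `b j → 1` do not affect the lower limit; subtracting the finite `a j` leaves
  -- convergent right-hand sides.
  have h2 : liminf (fun j => ∫⁻ z, u (k j) (τ (Q j) z) ∂P) atTop ≤ r₀ - a₀ := by
    have h3 := ENNReal.le_liminf_mul (f := atTop) (u := b)
      (v := fun j => ∫⁻ z, u (k j) (τ (Q j) z) ∂P)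
    rw [hb.liminf_eq, one_mul] at h3
    refine h3.trans ?_
    rw [← (ENNReal.Tendsto.sub hr ha (Or.inr ha₀)).liminf_eq]
    refine liminf_le_liminf (Eventually.of_forall fun j => ?_)
    exact ENNReal.le_sub_of_add_le_left (hatop j) (h j)
  have h4 : a₀ ≤ r₀ := le_of_tendsto_of_tendsto' ha hr fun j => le_self_add.trans (h j)
  calc a₀ + ∫⁻ z, relaxedLiminf u (τ Q₀ z) ∂P ≤ a₀ + (r₀ - a₀) := by gcongr; exact h1.trans h2
    _ = r₀ := add_tsub_cancel_of_le h4

end RelaxedLiminf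

/-! ### Limit points of sequences of decision rules. -/

section LimitPoints

variable {X K : Type*} [TopologicalSpace K]

/-- The limits of sequences `φ (k j) (x j)` with `k j → ∞`. -/
def limitPoints (φ : ℕ → X → K) : Set K :=
  ⋂ n, closure (⋃ k ≥ n, range (φ k))

lemma isClosed_limitPoints (φ : ℕ → X → K) : IsClosed (limitPoints φ) :=
  isClosed_iInter fun _ => isClosed_closure

lemma mem_limitPoints_of_tendsto {φ : ℕ → X → K} {k : ℕ → ℕ} {x : ℕ → X} {Q : K}
    (hk : Tendsto k atTop atTop) (hQ : Tendsto (fun j => φ (k j) (x j)) atTop (𝓝 Q)) :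
    Q ∈ limitPoints φ := by
  refine mem_iInter.2 fun n => mem_closure_of_tendsto hQ ?_
  filter_upwards [hk.eventually_ge_atTop n] with j hj
  exact mem_iUnion₂.2 ⟨k j, hj, mem_range_self _⟩

/-- The base points `x j` are not asked to converge; for decision rules their convergence follows
from continuity of the first marginal. -/
lemma exists_strictMono_of_mem_limitPoints [FirstCountableTopology K] {φ : ℕ → X → K} {Q : K}
    (hQ : Q ∈ limitPoints φ) : ∃ (k : ℕ → ℕ) (x : ℕ → X), StrictMono k ∧
      Tendsto (fun j => φ (k j) (x j)) atTop (𝓝 Q) := by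
  obtain ⟨V, hV⟩ := (𝓝 Q).exists_antitone_basis
  have h : ∀ j, ∃ᶠ k in atTop, ∃ x, φ k x ∈ V j := fun j => by
    refine frequently_atTop.2 fun n => ?_
    obtain ⟨Q', hQ', hmem⟩ := mem_closure_iff_nhds.1 (mem_iInter.1 hQ n) (V j) (hV.mem j)
    obtain ⟨k, hk, x, rfl⟩ := mem_iUnion₂.1 hmem
    exact ⟨k, hk, x, hQ'⟩
  obtain ⟨k, hk, hx⟩ := extraction_forall_of_frequently h
  choose x hx using hx
  exact ⟨k, x, hk, hV.tendsto hx⟩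

end LimitPoints

/-! ### From extended expectations to nonnegative costs. -/

section ExtExpectation

/-- Pointwise `f⁺ + (L - f) = L + f⁻` with all terms nonnegative, so it integrates without
subtraction; only `f⁻` and `L - f` can have infinite integral, and they do so together. -/
lemma extExpectation_eq_sub {Ω : Type*} [MeasurableSpace Ω] {P : Measure Ω}
    [IsProbabilityMeasure P] {f : Ω → ℝ} (hf : Measurable f) {L : ℝ} (hL : 0 ≤ L)
    (hfL : ∀ ω, f ω ≤ L) :
    extExpectation P f =
      (L : EReal) - ((∫⁻ ω, ENNReal.ofReal (L - f ω) ∂P : ℝ≥0∞) : EReal) := by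
  have hsum : ∫⁻ ω, ENNReal.ofReal (f ω) ∂P + ∫⁻ ω, ENNReal.ofReal (L - f ω) ∂P =
      ENNReal.ofReal L + ∫⁻ ω, ENNReal.ofReal (-(f ω)) ∂P := by
    have h : ∀ ω, ENNReal.ofReal (f ω) + ENNReal.ofReal (L - f ω) =
        ENNReal.ofReal L + ENNReal.ofReal (-(f ω)) := fun ω => by
      rcases le_total 0 (f ω) with h | h
      · rw [ENNReal.ofReal_of_nonpos (neg_nonpos.2 h), add_zero,
          ← ENNReal.ofReal_add h (sub_nonneg.2 (hfL ω)), add_sub_cancel]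
      · rw [ENNReal.ofReal_of_nonpos h, zero_add, ← ENNReal.ofReal_add hL (neg_nonneg.2 h),
          sub_eq_add_neg]
    rw [← lintegral_add_left hf.ennreal_ofReal, lintegral_congr h,
      lintegral_add_left measurable_const]
    simp
  have ha : ∫⁻ ω, ENNReal.ofReal (f ω) ∂P ≠ ⊤ := by
    refine ((lintegral_mono fun ω => ENNReal.ofReal_le_ofReal (hfL ω)).trans_lt ?_).ne
    simp
  unfold extExpectation
  generalize ∫⁻ ω, ENNReal.ofReal (f ω) ∂P = a at *
  generalize ∫⁻ ω, ENNReal.ofReal (L - f ω) ∂P = I at *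
  generalize ∫⁻ ω, ENNReal.ofReal (-(f ω)) ∂P = b at *
  lift a to NNReal using ha
  induction b with
  | top =>
    have : I = ⊤ := by simpa using hsum
    subst this
    rfl
  | coe b =>
    have hI : I ≠ ⊤ := by
      rintro rfl
      rw [add_top] at hsum
      exact ENNReal.add_ne_top.2 ⟨ENNReal.ofReal_ne_top, ENNReal.coe_ne_top⟩ hsum.symm
    lift I to NNReal using hI
    have h := congrArg ENNReal.toReal hsum
    rw [ENNReal.toReal_add (by simp) (by simp), ENNReal.toReal_add (by simp) (by simp),
      ENNReal.toReal_ofReal hL] at h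
    simp only [ENNReal.coe_toReal] at h
    change ((a : ℝ) : EReal) - ((b : ℝ) : EReal) = (L : EReal) - ((I : ℝ) : EReal)
    rw [← EReal.coe_sub, ← EReal.coe_sub]
    congr 1
    linarith

end ExtExpectation

lemma upperSemicontinuous_const_sub_toReal {E : Type*} [TopologicalSpace E] {g : E → ℝ≥0∞}
    (hg : LowerSemicontinuous g) (hgtop : ∀ x, g x ≠ ⊤) (L : ℝ) :
    UpperSemicontinuous fun x => L - (g x).toReal := by
  intro x y hy
  have hy' : L - y < (g x).toReal := by linarith [show L - (g x).toReal < y from hy]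
  rcases lt_or_ge (L - y) 0 with h | h
  · exact Eventually.of_forall fun x' => show L - (g x').toReal < y by
      linarith [ENNReal.toReal_nonneg (a := g x')]
  · filter_upwards [hg x _ ((ENNReal.ofReal_lt_iff_lt_toReal h (hgtop x)).2 hy')] with x' hx'
    have := (ENNReal.ofReal_lt_iff_lt_toReal h (hgtop x')).1 hx'
    linarith

/-- Translates the optimality inequality for `h = L - g` into one between costs. Adding `2C` keeps
both constants nonnegative; for `W = ⊤` both sides fail. -/
lemma coe_le_coe_sub_coe_iff {W G : ℝ≥0∞} (hG : G ≠ ⊤) {C L ρ : ℝ} (hC : 0 ≤ C)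
    (hCρ : 0 ≤ C + ρ) :
    ((ρ + (L - G.toReal) : ℝ) : EReal) ≤ ((C + L : ℝ) : EReal) - (W : EReal) ↔
      W + ENNReal.ofReal (C + ρ) ≤ G + ENNReal.ofReal (2 * C) := by
  lift G to NNReal using hG
  induction W with
  | top =>
    rw [top_add, top_le_iff, EReal.coe_ennreal_top, EReal.sub_top, le_bot_iff]
    exact iff_of_false (EReal.coe_ne_bot _)
      (ENNReal.add_ne_top.2 ⟨ENNReal.coe_ne_top, ENNReal.ofReal_ne_top⟩)
  | coe W =>
    change ((ρ + (L - G) : ℝ) : EReal) ≤ ((C + L : ℝ) : EReal) - ((W : ℝ) : EReal) ↔ _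
    rw [← EReal.coe_sub, EReal.coe_le_coe_iff, ← ENNReal.ofReal_coe_nnreal (p := W),
      ← ENNReal.ofReal_coe_nnreal (p := G), ← ENNReal.ofReal_add W.coe_nonneg hCρ,
      ← ENNReal.ofReal_add G.coe_nonneg (by positivity),
      ENNReal.ofReal_le_ofReal_iff (by positivity)]
    constructor <;> intro h <;> linarith

namespace MeanFieldModel

/-- The average optimality expression as a constant minus a cost. -/
lemma avgBellman_eq {S A 𝒵 : Type*} [MeasurableSpace S] [MeasurableSpace A]
    [MeasurableSpace 𝒵] {M : MeanFieldModel S A 𝒵} {C L : ℝ} (hC : ∀ Q, |M.reward Q| ≤ C) (hL : 0 ≤ L)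
    (hnext : Measurable fun q : ProbabilityMeasure M.graph × 𝒵 => M.next q.1 q.2)
    {g : ProbabilityMeasure S → ℝ≥0∞} (hg : Measurable g) (hgtop : ∀ μ, g μ ≠ ⊤)
    {μ : ProbabilityMeasure S} {Q : ProbabilityMeasure M.graph} (hQ : M.firstMargin Q = μ) :
    M.avgBellman (fun μ => L - (g μ).toReal) μ Q = ((C + L : ℝ) : EReal) -
      ((bellmanCost (M.lawZ0 : Measure 𝒵) M.next (fun Q => ENNReal.ofReal (C - M.reward Q)) 1 g Q
        : ℝ≥0∞) : EReal) := by
  subst hQ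
  have hgn : Measurable fun z => g (M.next Q z) := hg.comp (hnext.comp measurable_prodMk_left)
  unfold avgBellman
  change (M.reward Q : EReal) + extExpectation (M.lawZ0 : Measure 𝒵)
    (fun z => L - (g (M.next Q z)).toReal) = _
  rw [extExpectation_eq_sub (f := fun z => L - (g (M.next Q z)).toReal) (measurable_const.sub hgn.ennreal_toReal) hL
    fun z => sub_le_self _ ENNReal.toReal_nonneg]
  simp only [sub_sub_cancel, ENNReal.ofReal_toReal (hgtop _), bellmanCost, one_mul]
  have hnn : 0 ≤ C - M.reward Q := sub_nonneg.2 ((le_abs_self _).trans (hC Q))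
  generalize ∫⁻ z, g (M.next Q z) ∂(M.lawZ0 : Measure 𝒵) = I
  induction I with
  | top => simp
  | coe I =>
    rw [← ENNReal.ofReal_coe_nnreal, ← ENNReal.ofReal_add hnn I.coe_nonneg,
      EReal.coe_ennreal_ofReal, EReal.coe_ennreal_ofReal, max_eq_left I.coe_nonneg,
      max_eq_left (add_nonneg hnn I.coe_nonneg), ← EReal.coe_sub, ← EReal.coe_sub,
      ← EReal.coe_add]
    congr 1
    ring

/-! ### The vanishing discount limit. -/

section Topological

variable {S A 𝒵 : Type*} [MeasurableSpace S] [MeasurableSpace A] [MeasurableSpace 𝒵]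
    [TopologicalSpace S] [CompactSpace S] [TopologicalSpace.MetrizableSpace S]
    [SecondCountableTopology S] [BorelSpace S]
    [TopologicalSpace A] [TopologicalSpace.MetrizableSpace A]
    [SecondCountableTopology A] [BorelSpace A]
    [TopologicalSpace 𝒵] [TopologicalSpace.MetrizableSpace 𝒵]
    [SecondCountableTopology 𝒵] [BorelSpace 𝒵]
    {M : MeanFieldModel S A 𝒵}

/-- The discounted optimality equation in terms of the relative cost `L - (J^β(μ) - J^β(ν))`. -/
lemma relative_optimality_equation [CompactSpace M.graph] (hr : M.ContinuousReward)
    (hT : M.ContinuousTransition) {C : ℝ} (hC : ∀ Q, |M.reward Q| ≤ C) {β : ℝ}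
    (hβ : β ∈ Ioo (0 : ℝ) 1) {L : ℝ} (hL : 0 ≤ L) {ν : ProbabilityMeasure S}
    (hJL : ∀ μ, M.discValue β μ - M.discValue β ν ≤ L) {φ : M.DecisionRule}
    (hφ : M.IsDiscountOptimal β φ) (μ : ProbabilityMeasure S) :
    ENNReal.ofReal (C - M.reward (φ.1 μ))
        + ENNReal.ofReal (C + (1 - β) * (L + M.discValue β ν))
        + ENNReal.ofReal β * ∫⁻ z, ENNReal.ofReal
          (L - (M.discValue β (M.next (φ.1 μ) z) - M.discValue β ν)) ∂(M.lawZ0 : Measure 𝒵) =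
      ENNReal.ofReal (L - (M.discValue β μ - M.discValue β ν)) + ENNReal.ofReal (2 * C) := by
  have : Nonempty M.Policy := ⟨stationary φ⟩
  have hβ1 : 0 < 1 - β := sub_pos.2 hβ.2
  have hC0 : 0 ≤ C := (abs_nonneg _).trans (hC (φ.1 μ))
  obtain ⟨hJm, -, hbell⟩ := discount_optimality hr hT hβ
  have hJb : ∀ μ, |M.discValue β μ| ≤ C / (1 - β) := fun μ => by
    have := abs_discValue_le hC hβ μ
    rwa [abs_mul, abs_of_pos hβ1, ← le_div_iff₀' hβ1] at this
  have hint : Integrable (fun z => M.discValue β (M.next (φ.1 μ) z)) (M.lawZ0 : Measure 𝒵) :=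
    Integrable.of_bound
      (hJm.comp ((measurable_next hT).comp measurable_prodMk_left)).aestronglyMeasurable
      (C / (1 - β)) (Eventually.of_forall fun z => hJb _)
  have hint' : Integrable (fun z => L - (M.discValue β (M.next (φ.1 μ) z) - M.discValue β ν))
      (M.lawZ0 : Measure 𝒵) := (integrable_const L).sub (hint.sub (integrable_const _))
  have hI : ∫ z, (L - (M.discValue β (M.next (φ.1 μ) z) - M.discValue β ν))
      ∂(M.lawZ0 : Measure 𝒵) =
      L - (∫ z, M.discValue β (M.next (φ.1 μ) z) ∂(M.lawZ0 : Measure 𝒵) - M.discValue β ν) := by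
    rw [integral_sub (f := fun _ => L)
      (g := fun z => M.discValue β (M.next (φ.1 μ) z) - M.discValue β ν)
      (integrable_const L) (hint.sub (integrable_const _)),
      integral_sub (f := fun z => M.discValue β (M.next (φ.1 μ) z))
      (g := fun _ => M.discValue β ν) hint (integrable_const _)]
    simp
  have hnn : ∀ z, 0 ≤ L - (M.discValue β (M.next (φ.1 μ) z) - M.discValue β ν) := fun z =>
    sub_nonneg.2 (hJL _)
  have hInn : 0 ≤ ∫ z, (L - (M.discValue β (M.next (φ.1 μ) z) - M.discValue β ν))
      ∂(M.lawZ0 : Measure 𝒵) := integral_nonneg fun z => hnn z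
  have h1 : 0 ≤ C - M.reward (φ.1 μ) := sub_nonneg.2 ((le_abs_self _).trans (hC _))
  have h2 : 0 ≤ C + (1 - β) * (L + M.discValue β ν) := by
    have := neg_le_of_abs_le (abs_discValue_le hC hβ ν)
    have := mul_nonneg hβ1.le hL
    linarith
  rw [← ofReal_integral_eq_lintegral_ofReal hint' (Eventually.of_forall hnn),
    ← ENNReal.ofReal_mul hβ.1.le, ← ENNReal.ofReal_add h1 h2,
    ← ENNReal.ofReal_add (add_nonneg h1 h2) (mul_nonneg hβ.1.le hInn),
    ← ENNReal.ofReal_add (sub_nonneg.2 (hJL μ)) (by positivity), hI]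
  congr 1
  linarith [hbell φ hφ μ]

/-- Vanishing discount: over every state some limit point of the discounted optimal actions
satisfies the average reward optimality inequality. -/
lemma exists_limitPoint_optimality_inequality [CompactSpace M.graph] (hr : M.ContinuousReward)
    (hT : M.ContinuousTransition) {C : ℝ} (hC : ∀ Q, |M.reward Q| ≤ C) {β : ℕ → ℝ}
    (hβ : ∀ k, β k ∈ Ioo (0 : ℝ) 1) (hβ1 : Tendsto β atTop (𝓝 1)) {L ρ : ℝ} (hL : 0 ≤ L)
    {ν : ProbabilityMeasure S}
    (hJL : ∀ k μ, M.discValue (β k) μ - M.discValue (β k) ν ≤ L)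
    (hρ : Tendsto (fun k => (1 - β k) * M.discValue (β k) ν) atTop (𝓝 ρ))
    {φ : ℕ → M.DecisionRule} (hφ : ∀ k, M.IsDiscountOptimal (β k) (φ k))
    {μ : ProbabilityMeasure S}
    (htop : relaxedLiminf (fun k μ =>
      ENNReal.ofReal (L - (M.discValue (β k) μ - M.discValue (β k) ν))) μ ≠ ⊤) :
    ∃ Q ∈ limitPoints fun k => (φ k).1, M.firstMargin Q = μ ∧
      bellmanCost (M.lawZ0 : Measure 𝒵) M.next (fun Q => ENNReal.ofReal (C - M.reward Q)) 1
          (relaxedLiminf fun k μ =>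
            ENNReal.ofReal (L - (M.discValue (β k) μ - M.discValue (β k) ν))) Q
        + ENNReal.ofReal (C + ρ) ≤
      relaxedLiminf (fun k μ =>
        ENNReal.ofReal (L - (M.discValue (β k) μ - M.discValue (β k) ν))) μ
        + ENNReal.ofReal (2 * C) := by
  set u : ℕ → ProbabilityMeasure S → ℝ≥0∞ := fun k μ =>
    ENNReal.ofReal (L - (M.discValue (β k) μ - M.discValue (β k) ν)) with hu
  -- Realize the relaxed limit at `μ` along states `x j → μ`, then extract a limit of the optimal
  -- actions taken there.
  obtain ⟨k, x, hk, hx, hux⟩ := exists_seq_lt_relaxedLiminf_add htop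
  obtain ⟨Q, -, s, hs, hQ⟩ := isCompact_univ.tendsto_subseq
    (fun j => mem_univ ((φ (k j)).1 (x j)))
  have hks := hk.comp hs.tendsto_atTop
  refine ⟨Q, mem_limitPoints_of_tendsto (φ := fun k => (φ k).1) hks hQ, ?_, ?_⟩
  · refine tendsto_nhds_unique ((M.continuous_firstMargin.tendsto Q).comp hQ) ?_
    refine (hx.comp hs.tendsto_atTop).congr fun j => ?_
    exact (firstMargin_decisionRule (φ (k (s j))) (x (s j))).symm
  · have hcont : Continuous fun Q => ENNReal.ofReal (C - M.reward Q) :=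
      ENNReal.continuous_ofReal.comp (continuous_const.sub (M.continuous_reward hr))
    -- The term `(1 - β) L` vanishes, so only `ρ` remains of the normalization.
    have ha : Tendsto (fun j => (1 - β j) * (L + M.discValue (β j) ν)) atTop (𝓝 ρ) := by
      have := ((hβ1.const_sub 1).mul_const L).add hρ
      simpa [← mul_add] using this
    have ha' : Tendsto (fun j => ENNReal.ofReal (C - M.reward ((φ (k (s j))).1 (x (s j))))
        + ENNReal.ofReal (C + (1 - β (k (s j))) * (L + M.discValue (β (k (s j))) ν))) atTop
        (𝓝 (ENNReal.ofReal (C - M.reward Q) + ENNReal.ofReal (C + ρ))) :=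
      ((hcont.tendsto Q).comp hQ).add
        (ENNReal.tendsto_ofReal ((ha.const_add C).comp hks))
    have hb : Tendsto (fun j => ENNReal.ofReal (β (k (s j)))) atTop (𝓝 1) := by
      simpa using ENNReal.tendsto_ofReal (hβ1.comp hks)
    have hr₀ : Tendsto (fun j => relaxedLiminf u μ + ((s j : ℝ≥0∞) + 1)⁻¹
        + ENNReal.ofReal (2 * C)) atTop (𝓝 (relaxedLiminf u μ + ENNReal.ofReal (2 * C))) := by
      have h0 : Tendsto (fun j : ℕ => ((j : ℝ≥0∞) + 1)⁻¹) atTop (𝓝 0) := by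
        have := (ENNReal.tendsto_inv_nat_nhds_zero).comp (tendsto_add_atTop_nat 1)
        simpa [Function.comp_def] using this
      simpa using ((h0.comp hs.tendsto_atTop).const_add (relaxedLiminf u μ)).add_const
        (ENNReal.ofReal (2 * C))
    have hum : ∀ k, Measurable (u k) := fun k =>
      (measurable_const.sub ((discount_optimality hr hT (hβ k)).1.sub_const _)).ennreal_ofReal
    have := lintegral_relaxedLiminf_add_le (P := (M.lawZ0 : Measure 𝒵)) (M.continuous_next hT)
      hum hks hQ hb ha' hr₀
      (fun j => ENNReal.add_ne_top.2 ⟨ENNReal.ofReal_ne_top, ENNReal.ofReal_ne_top⟩)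
      (ENNReal.add_ne_top.2 ⟨ENNReal.ofReal_ne_top, ENNReal.ofReal_ne_top⟩)
      (fun j => by
        have h := relative_optimality_equation hr hT hC (hβ (k (s j))) hL (hJL _)
          (hφ (k (s j))) (x (s j))
        refine h.le.trans ?_
        gcongr
        exact hux (s j))
    unfold bellmanCost
    rw [one_mul, add_right_comm]
    exact this

end Topological

end MeanFieldModel

end

/-! ### Assembly of the theorem. -/

theorem theorem5p3 {S A 𝒵 : Type*}
    [TopologicalSpace S] [CompactSpace S] [TopologicalSpace.MetrizableSpace S]
    [SecondCountableTopology S] [MeasurableSpace S] [BorelSpace S]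
    [TopologicalSpace A] [TopologicalSpace.MetrizableSpace A]
    [SecondCountableTopology A] [MeasurableSpace A] [BorelSpace A]
    [TopologicalSpace 𝒵] [TopologicalSpace.MetrizableSpace 𝒵]
    [SecondCountableTopology 𝒵] [MeasurableSpace 𝒵] [BorelSpace 𝒵]
    (M : MeanFieldModel S A 𝒵) (ν : ProbabilityMeasure S)
    (hA0 : M.CompactGraph) (hA1 : M.UpperSemicontinuousConstraint)
    (hA2 : M.ContinuousReward) (hA3 : M.ContinuousTransition) (hA4 : M.Ergodic ν) :
    ∃ (ρ : ℝ) (h : ProbabilityMeasure S → ℝ),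
      -- the average reward optimality inequality
      UpperSemicontinuous h ∧
      (∀ μ, ((ρ + h μ : ℝ) : EReal) ≤ ⨆ Q ∈ M.admissible μ, M.avgBellman h μ Q) ∧
      (∃ φ : M.DecisionRule, M.IsMaximizer h φ) ∧
      -- maximizers are average optimal, and `ρ` is the maximal average reward
      (∀ φ : M.DecisionRule, M.IsMaximizer h φ →
        M.IsAverageOptimal (MeanFieldModel.stationary φ)) ∧
      ρ = limsup (fun β : ℝ => (1 - β) * M.discValue β ν) (𝓝[<] 1) ∧
      (∀ μ, M.avgValue μ = ρ) ∧
      -- average optimal rules as limits of discounted optimal rules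
      (∀ β ∈ Ioo (0 : ℝ) 1, ∃ φ : M.DecisionRule, M.IsDiscountOptimal β φ) ∧
      (∀ φβ : ℝ → M.DecisionRule, (∀ β ∈ Ioo (0 : ℝ) 1, M.IsDiscountOptimal β (φβ β)) →
        ∃ φ0 : M.DecisionRule,
          (∀ μ : ProbabilityMeasure S, ∃ (b : ℕ → ℝ) (μs : ℕ → ProbabilityMeasure S),
            StrictMono b ∧ (∀ n, b n ∈ Ioo (0 : ℝ) 1) ∧ Tendsto b atTop (𝓝 1) ∧
            Tendsto μs atTop (𝓝 μ) ∧
            Tendsto (fun n => (φβ (b n)).1 (μs n)) atTop (𝓝 (φ0.1 μ))) ∧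
          M.IsAverageOptimal (MeanFieldModel.stationary φ0)) := by
  have hK : CompactSpace M.graph := isCompact_iff_compactSpace.1 hA0
  obtain ⟨C, hC0, hC⟩ := M.exists_bound_reward
  obtain ⟨L, hL0, βbar, hβbar, m, hm⟩ := hA4
  have hRm := (M.continuous_reward hA2).measurable
  have hnext := MeanFieldModel.measurable_next hA3
  have hopt : ∀ β ∈ Ioo (0 : ℝ) 1, ∃ φ : M.DecisionRule, M.IsDiscountOptimal β φ := fun β hβ =>
    (MeanFieldModel.discount_optimality hA2 hA3 hβ).2.1
  have hne : Nonempty M.Policy := by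
    obtain ⟨φ, -⟩ := hopt βbar hβbar
    exact ⟨MeanFieldModel.stationary φ⟩
  obtain ⟨β, hβmono, hβ', hβ1, hρ⟩ := exists_strictMono_tendsto_limsup_nhdsLT
    (f := fun β : ℝ => (1 - β) * M.discValue β ν) (C := C) hβbar.2 (by
      filter_upwards [Ioo_mem_nhdsLT (zero_lt_one' ℝ)] with β hβ
      exact MeanFieldModel.abs_discValue_le hC hβ ν)
  set ρ := limsup (fun β : ℝ => (1 - β) * M.discValue β ν) (𝓝[<] 1)
  have hβ : ∀ k, β k ∈ Ioo (0 : ℝ) 1 := fun k => ⟨hβbar.1.trans (hβ' k).1, (hβ' k).2⟩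
  have hJ : ∀ k μ, m μ ≤ M.discValue (β k) μ - M.discValue (β k) ν ∧
      M.discValue (β k) μ - M.discValue (β k) ν ≤ L := fun k μ =>
    hm μ (β k) ⟨(hβ' k).1.le, (hβ' k).2⟩
  have hCρ : 0 ≤ C + ρ := by
    have : -C ≤ ρ := ge_of_tendsto hρ (Eventually.of_forall fun k =>
      neg_le_of_abs_le (MeanFieldModel.abs_discValue_le hC (hβ k) ν))
    linarith
  let g : ProbabilityMeasure S → ℝ≥0∞ := relaxedLiminf fun k μ =>
    ENNReal.ofReal (L - (M.discValue (β k) μ - M.discValue (β k) ν))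
  have hg : LowerSemicontinuous g := lowerSemicontinuous_relaxedLiminf
  -- Here the lower bound `m` of the ergodicity condition makes `h` real-valued.
  have hgtop : ∀ μ, g μ ≠ ⊤ := fun μ => by
    have hle : g μ ≤ ENNReal.ofReal (L - m μ) := relaxedLiminf_le fun k =>
      ENNReal.ofReal_le_ofReal (by linarith [(hJ k μ).1])
    exact (hle.trans_lt ENNReal.ofReal_lt_top).ne
  let c : ProbabilityMeasure M.graph → ℝ≥0∞ := fun Q => ENNReal.ofReal (C - M.reward Q)
  have hc : Continuous c :=
    ENNReal.continuous_ofReal.comp (continuous_const.sub (M.continuous_reward hA2))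
  let W : ProbabilityMeasure M.graph → ℝ≥0∞ :=
    bellmanCost (M.lawZ0 : Measure 𝒵) M.next c 1 g
  have hW : LowerSemicontinuous W := lowerSemicontinuous_bellmanCost hg (M.continuous_next hA3)
    hc.lowerSemicontinuous ENNReal.one_ne_top
  let h : ProbabilityMeasure S → ℝ := fun μ => L - (g μ).toReal
  have havg : ∀ {μ Q}, M.firstMargin Q = μ →
      M.avgBellman h μ Q = ((C + L : ℝ) : EReal) - (W Q : EReal) := fun hQ =>
    MeanFieldModel.avgBellman_eq hC hL0.le hnext hg.measurable hgtop hQ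
  have hiff : ∀ μ Q, ((ρ + h μ : ℝ) : EReal) ≤ ((C + L : ℝ) : EReal) - (W Q : EReal) ↔
      W Q + ENNReal.ofReal (C + ρ) ≤ g μ + ENNReal.ofReal (2 * C) := fun μ Q =>
    coe_le_coe_sub_coe_iff (hgtop μ) hC0 hCρ
  have hlim : ∀ φβ : ℝ → M.DecisionRule,
      (∀ β ∈ Ioo (0 : ℝ) 1, M.IsDiscountOptimal β (φβ β)) → ∀ μ,
      ∃ Q ∈ limitPoints fun k => (φβ (β k)).1, M.firstMargin Q = μ ∧
        W Q + ENNReal.ofReal (C + ρ) ≤ g μ + ENNReal.ofReal (2 * C) := fun φβ hφβ μ =>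
    MeanFieldModel.exists_limitPoint_optimality_inequality hA2 hA3 hC hβ hβ1 hL0.le
      (fun k μ => (hJ k μ).2) hρ (fun k => hφβ _ (hβ k)) (hgtop μ)
  have hupper : ∀ ψ μ, M.avgReward ψ μ ≤ ρ := fun ψ μ =>
    MeanFieldModel.avgReward_le hC hβ hβ1 (fun k => (hJ k μ).2) hρ ψ
  have hlower : ∀ φ : M.DecisionRule,
      (∀ μ, W (φ.1 μ) + ENNReal.ofReal (C + ρ) ≤ g μ + ENNReal.ofReal (2 * C)) →
      ∀ μ, M.avgReward (MeanFieldModel.stationary φ) μ = ρ := fun φ hφ μ =>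
    le_antisymm (hupper _ μ)
      (MeanFieldModel.le_avgReward_stationary hC hRm hnext hCρ hg.measurable hgtop φ hφ μ)
  have hsup : ∀ μ, ((ρ + h μ : ℝ) : EReal) ≤ ⨆ Q ∈ M.admissible μ, M.avgBellman h μ Q := by
    intro μ
    -- Supplies `choose!` with a value for `β` outside the unit interval.
    have : Nonempty M.DecisionRule := ⟨hne.some 0⟩
    choose! φβ hφβ using hopt
    obtain ⟨Q, -, hQ, hle⟩ := hlim φβ hφβ μ
    refine le_trans ?_ (le_iSup₂ Q hQ)
    rw [havg hQ]
    exact (hiff μ Q).2 hle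
  have hmax : ∃ φ : M.DecisionRule, M.IsMaximizer h φ := by
    obtain ⟨φ, hφ⟩ := MeanFieldModel.exists_decisionRule_argmax (M := M) isClosed_univ
      (fun μ => (M.exists_firstMargin_eq μ).imp fun Q hQ => ⟨mem_univ Q, hQ⟩)
      (upperSemicontinuous_neg_coe hW)
    refine ⟨φ, fun μ => le_antisymm (le_iSup₂ (f := fun Q _ => M.avgBellman h μ Q)
      (φ.1 μ) (φ.2.2 μ)) (iSup₂_le fun Q hQ => ?_)⟩
    rw [havg hQ, havg (φ.2.2 μ), sub_eq_add_neg, sub_eq_add_neg]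
    exact add_le_add le_rfl ((hφ μ).2 Q (mem_univ Q) hQ)
  have hmaxle : ∀ φ : M.DecisionRule, M.IsMaximizer h φ →
      ∀ μ, M.avgReward (MeanFieldModel.stationary φ) μ = ρ := by
    intro φ hφ
    refine hlower φ fun μ => (hiff μ _).1 ?_
    rw [← havg (φ.2.2 μ), hφ μ]
    exact hsup μ
  have hval : ∀ μ, M.avgValue μ = ρ := by
    intro μ
    obtain ⟨φ, hφ⟩ := hmax
    refine le_antisymm (ciSup_le fun ψ => hupper ψ μ) ?_
    rw [← hmaxle φ hφ μ]
    exact le_ciSup (f := fun ψ : M.Policy => M.avgReward ψ μ)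
      ⟨ρ, by rintro _ ⟨ψ, rfl⟩; exact hupper ψ μ⟩ _
  refine ⟨ρ, h, upperSemicontinuous_const_sub_toReal hg hgtop L, hsup, hmax,
    fun φ hφ μ => (hmaxle φ hφ μ).trans (hval μ).symm, rfl, hval, hopt, fun φβ hφβ => ?_⟩
  -- Minimize `W` over the limit points only: the result is still a limit of discounted optimal
  -- actions, though it need not minimize over all admissible ones.
  obtain ⟨φ, hφ⟩ := MeanFieldModel.exists_decisionRule_argmax (M := M)
    (isClosed_limitPoints fun k => (φβ (β k)).1)
    (fun μ => by
      obtain ⟨Q, hQ, hμ, -⟩ := hlim φβ hφβ μ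
      exact ⟨Q, hQ, hμ⟩)
    (upperSemicontinuous_neg_coe hW)
  refine ⟨φ, fun μ => ?_, fun μ => (hlower φ (fun μ => ?_) μ).trans (hval μ).symm⟩
  · obtain ⟨k, x, hk, hx⟩ := exists_strictMono_of_mem_limitPoints (hφ μ).1
    refine ⟨fun j => β (k j), x, hβmono.comp hk, fun j => hβ _, hβ1.comp hk.tendsto_atTop, ?_, hx⟩
    have := (M.continuous_firstMargin.tendsto (φ.1 μ)).comp hx
    rw [MeanFieldModel.firstMargin_decisionRule] at this
    exact this.congr fun j => MeanFieldModel.firstMargin_decisionRule (φβ (β (k j))) (x j)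
  -- The limit point `Q` from the vanishing discount competes in this minimization, so the minimizer
  -- inherits its inequality.
  · obtain ⟨Q, hQ, hμ, hle⟩ := hlim φβ hφβ μ
    have hWle : W (φ.1 μ) ≤ W Q := by
      have := (hφ μ).2 Q hQ hμ
      rwa [EReal.neg_le_neg_iff, EReal.coe_ennreal_le_coe_ennreal_iff] at this
    exact (add_le_add_left hWle _).trans hle
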